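/- Let $k=\overline{\mathbb F}_2$ and let $\mathcal O=W(k)$ be its ring of Witt vectors. Let $q$ be a prime power with $4\mid q-1$ and $8\nmid q-1$, let $r\ge 0$, let $H=Sp_{2r}(q)$, and let $b$ be a block of $\mathcal O H$ whose defect groups are isomorphic to $Q_8\times C_4$. Let $G$ be a finite group containing $H$ as a normal subgroup such that $C_G(H)\le H$, and let $B$ be a block of $\mathcal O G$ covering $b$, with defect group $D$. Then $D$ is not isomorphic to $Q_8\times Q_8$. (This holds for all such $b$; in particular it holds for those labelled, in the usual parametrisation of $2$-blocks of $Sp_{2r}(q)$ by semisimple classes of odd order in the dual group, by some $s\in SO_{2r+1}(q)$ for which the elementary divisor $X-1$ has multiplicity $3$ and every other elementary divisor has multiplicity at most $1$.) -/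

import Mathlib

namespace BlockTheory

universe u v w

/-- The complete discrete valuation ring `𝒪`: the ring of `2`-typical Witt vectors over the
algebraic closure `k` of the field with two elements. -/
abbrev O : Type := WittVector 2 (AlgebraicClosure (ZMod 2))

section GroupRing

variable {R : Type u} [CommRing R] {G : Type v} [Group G] {H : Type w} [Group H]

/-- `e` is a block idempotent of the group ring `RG`, i.e. a primitive idempotent of the center
of `RG`; the corresponding block is the two-sided ideal `RG e`. -/
structure IsBlock (e : MonoidAlgebra R G) : Prop where
  idem : IsIdempotentElem e
  central : e ∈ Subring.center (MonoidAlgebra R G)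
  ne_zero : e ≠ 0
  primitive : ∀ f : MonoidAlgebra R G, IsIdempotentElem f →
    f ∈ Subring.center (MonoidAlgebra R G) → e * f = f → f = 0 ∨ f = e

/-- The conjugate `g a g⁻¹` of an element `a` of the group ring by a group element `g`. -/
noncomputable def conj (g : G) (a : MonoidAlgebra R G) : MonoidAlgebra R G :=
  MonoidAlgebra.of R G g * a * MonoidAlgebra.of R G g⁻¹

/-- `a` lies in `(RG)^P`, the fixed points under conjugation by the subgroup `P`. -/
def IsFixedBy (P : Subgroup G) (a : MonoidAlgebra R G) : Prop :=
  ∀ g ∈ P, conj g a = a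

/-- The relative trace `Tr_P^G(a)`, the sum of the conjugates `g a g⁻¹` with `g` running over a
set of representatives of the left cosets `gP`. On `(RG)^P` it does not depend on the
representatives, see `relTrace_eq`. -/
noncomputable def relTrace (P : Subgroup G) (a : MonoidAlgebra R G) : MonoidAlgebra R G :=
  ∑ᶠ x : G ⧸ P, conj x.out a

theorem conj_mul (g h : G) (a : MonoidAlgebra R G) : conj (g * h) a = conj g (conj h a) := by
  simp only [conj, mul_inv_rev, map_mul, mul_assoc]

theorem relTrace_eq (P : Subgroup G) (a : MonoidAlgebra R G) (ha : IsFixedBy P a)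
    (s : G ⧸ P → G) (hs : ∀ x, (s x : G ⧸ P) = x) :
    relTrace P a = ∑ᶠ x : G ⧸ P, conj (s x) a := by
  unfold relTrace
  congr 1
  funext x
  have hx : (x.out)⁻¹ * s x ∈ P := by
    rw [← QuotientGroup.eq, hs, QuotientGroup.out_eq']
  rw [show s x = x.out * ((x.out)⁻¹ * s x) by group, conj_mul, ha _ hx]

/-- `P` is a defect group of the block with block idempotent `e`: a subgroup of `G` that is
minimal, with respect to inclusion, subject to `e ∈ Tr_P^G((RG)^P)`. -/
def IsDefectGroup (e : MonoidAlgebra R G) (P : Subgroup G) : Prop :=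
  Minimal (fun Q : Subgroup G => ∃ a : MonoidAlgebra R G, IsFixedBy Q a ∧ relTrace Q a = e) P

/-- For an embedding `ι` of `H` as a normal subgroup of `G`: the block of `G` with idempotent `B`
covers the block of `H` with idempotent `b`, that is, `B b ≠ 0` in `RG`. -/
def Covers (ι : H →* G) (B : MonoidAlgebra R G) (b : MonoidAlgebra R H) : Prop :=
  B * MonoidAlgebra.mapDomainRingHom R ι b ≠ 0

end GroupRing

/-- The symplectic group `Sp_{2r}(F)` of `2r × 2r` matrices `A` with `A J Aᵀ = J`, where `J` is
the matrix of a nondegenerate alternating form. -/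
abbrev Sp (r : ℕ) (F : Type u) [Field F] : Type u := Matrix.symplecticGroup (Fin r) F

/-- The quaternion group of order `8`. -/
abbrev Q8 : Type := QuaternionGroup 2

/-- The cyclic group of order `4`. -/
abbrev C4 : Type := Multiplicative (ZMod 4)

end BlockTheory

/-! Suppose that `D ≅ Q₈ × Q₈`. Block theory enters only through one element `x₀` of `H`, at which
`b` has an odd coefficient and which is centralized by a `G`-conjugate of `D`. It exists because the
Brauer construct of `B` at `D` is nonzero (`IsDefectGroup.exists_not_two_dvd_coeff`) and `B` lies
under the sum of the `G`-conjugates of `b` (`exists_centralized_not_two_dvd_coeff`). On the other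
hand `b` is a relative trace from `P`, so every `2`-subgroup of `C_H(x₀)` is conjugate into `P ≅ Q₈
× C₄` and has order at most `32` (`exists_conj_mem_of_not_two_dvd_coeff`).

Replace `D` by that conjugate. Its elements act on `H` by automorphisms of order dividing `4`.
Automorphisms of a symplectic group are induced by semilinear maps, since they permute transvection
subgroups (`exists_semilinear`); as `q ≡ 5 (mod 8)` is not a square, no field automorphism is left
over, and each element of `D` is induced by a similitude (`exists_similitude`). If the multiplier is
a square, the automorphism is inner and the element lies in `H`, because `C_G(H) ≤ H`. Hence `R = D
∩ H` has index at most `2` in `D`, so it has order `32` and is conjugate to `P`. Having a central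
element of order `4`, it is `⟨c⟩ × ⟨i, j⟩` with `⟨i, j⟩ ≅ Q₈` one factor of `D`; an element `d` of
the other factor lies outside `R`, inverts `c`, centralizes `i` and `j`, and comes from a similitude
`g` whose multiplier `l` is not a square.

The contradiction is an extra isometry (`false_of_similitude`). Since `2` is not a square either, `2
* l` is one. The enveloping algebra of `R` contains an `s` with `s² = -1` and adjoint `-s`, so `1 +
s` is a similitude of multiplier `2`, and a scalar multiple of `(1 + s) * g` is an element `h` of
`H`. It centralizes `x₀`, normalizes `R` and sends `j` to `k * j` with `k` of order `4`. As `R` has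
maximal order among the `2`-subgroups of `C_H(x₀)`, an odd power of `h` lies in `R`; but odd powers
of `h` move `j` by an element of order `4`, and elements of `R` move it only by `1` or `i²`. -/

section

/-! ### Sums modulo `2` and local corners of commutative rings. -/

open Finset

/-- Congruence mod `2` for a sum of an invariant function over a set acted on by a `2`-group. -/
theorem IsPGroup.two_dvd_sum_of_two_dvd_fixedPoints {R D X : Type*} [CommRing R] [Group D]
    [Finite D] [Fintype X] [MulAction D X] (hD : IsPGroup 2 D) (f : X → R)
    (hf : ∀ (d : D) (x : X), f (d • x) = f x)
    (hfix : ∀ x : X, (∀ d : D, d • x = x) → 2 ∣ f x) : 2 ∣ ∑ x, f x := by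
  classical
  rw [← Finset.sum_fiberwise_of_maps_to (t := univ.image f) (g := f)
    (fun x _ => Finset.mem_image_of_mem f (mem_univ x))]
  refine Finset.dvd_sum fun c _ => ?_
  rw [Finset.sum_congr rfl (g := fun _ => c) (fun x hx => (mem_filter.1 hx).2), Finset.sum_const,
    nsmul_eq_mul]
  by_cases hc : (2 : R) ∣ c
  · exact hc.mul_left _
  refine Dvd.dvd.mul_right ?_ c
  let Y : SubMulAction D X :=
    { carrier := {x | f x = c}
      smul_mem' := fun d x hx => (hf d x).trans hx }
  have h := hD.card_modEq_card_fixedPoints Y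
  have he : IsEmpty (MulAction.fixedPoints D Y) := by
    refine ⟨fun y => hc ?_⟩
    have := hfix y.1.1 fun d => congrArg Subtype.val (y.2 d)
    rwa [show f y.1.1 = c from y.1.2] at this
  rw [show Nat.card (MulAction.fixedPoints D Y) = 0 from Nat.card_of_isEmpty,
    Nat.modEq_zero_iff_dvd] at h
  have hcard : Nat.card Y = #{x | f x = c} := by
    rw [← Nat.card_eq_finsetCard]
    refine Nat.card_congr (Equiv.subtypeEquivRight fun x => ?_)
    change f x = c ↔ _
    simp
  rw [hcard] at h
  exact_mod_cast Nat.cast_dvd_cast (α := R) h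

section LocalIdempotent

variable {Z : Type*} [CommRing Z]

/-- In a Henselian pair with Artinian quotient, the corner at a primitive idempotent is local. -/
theorem exists_mul_eq_or_exists_one_sub_mul_eq (I : Ideal Z) [HenselianRing Z I]
    [IsArtinianRing (Z ⧸ I)] {B : Z} (hB : ∀ e : Z, e * e = e → e * B = 0 ∨ e * B = B) (x : Z) :
    (∃ y, x * y * B = B) ∨ ∃ y, (1 - x) * y * B = B := by
  -- The descending chain of powers of `x` stabilizes modulo `I`, so `x ^ N * y ^ N` is idempotent
  -- there. Hensel's lemma for `X ^ 2 - X` lifts it to an idempotent `e`; the derivative `2 * e - 1`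
  -- squares to `1` modulo `I`.
  obtain ⟨n, y, hy⟩ := IsArtinian.exists_pow_succ_smul_dvd (R := Z ⧸ I) (M := Z ⧸ I)
    (Ideal.Quotient.mk I x) 1
  obtain ⟨y, rfl⟩ := Ideal.Quotient.mk_surjective y
  simp only [smul_eq_mul, mul_one] at hy
  set N := n + 1 with hN
  set π := Ideal.Quotient.mk I
  have h1 : π x ^ N * π y = π x ^ n := hy
  have h2 : ∀ j, π x ^ (n + j) * π y ^ j = π x ^ n := by
    intro j
    induction j with
    | zero => simp
    | succ j ih =>
      calc π x ^ (n + (j + 1)) * π y ^ (j + 1) = (π x ^ (n + 1) * π y) * (π x ^ j * π y ^ j) := by ring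
        _ = π x ^ (n + j) * π y ^ j := by rw [← hN, h1]; ring
        _ = _ := ih
  have h3 : π x ^ (N + N) * π y ^ N = π x ^ N := by
    calc π x ^ (N + N) * π y ^ N = (π x ^ (n + N) * π y ^ N) * π x := by rw [hN]; ring
      _ = _ := by rw [h2, hN, pow_succ]
  obtain ⟨e, he, hed⟩ := HenselianRing.is_henselian (I := I)
    (Polynomial.X ^ 2 - Polynomial.X) (by monicity!) (x ^ N * y ^ N) (by
      rw [← Ideal.Quotient.eq_zero_iff_mem]
      simp only [Polynomial.eval_sub, Polynomial.eval_pow, Polynomial.eval_X, map_sub, map_mul,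
        map_pow]
      change (π x ^ N * π y ^ N) ^ 2 - π x ^ N * π y ^ N = 0
      linear_combination (π y ^ N) * h3) (by
      refine IsUnit.of_mul_eq_one (π (2 * (x ^ N * y ^ N) - 1)) ?_
      simp only [Polynomial.derivative_X_pow, Polynomial.derivative_X,
        Polynomial.eval_sub, Polynomial.eval_mul, Polynomial.eval_pow, Polynomial.eval_X,
        Polynomial.eval_one, map_sub, map_mul, map_pow]
      simp
      change (2 * (π x ^ N * π y ^ N) - 1) * (2 * (π x ^ N * π y ^ N) - 1) = 1
      linear_combination (4 * π y ^ N) * h3)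
  have hunit : ∀ w ∈ I, ∃ u, (1 - w) * u = 1 := by
    intro w hw
    have := HenselianRing.jac (I := I) hw
    rw [Ideal.mem_jacobson_bot] at this
    obtain ⟨u, hu⟩ := (this (-1)).exists_right_inv
    exact ⟨u, by linear_combination hu⟩
  have hee : e * e = e := by
    have : e ^ 2 - e = 0 := by simpa [Polynomial.IsRoot] using he
    linear_combination this
  rcases hB e hee with h | h
  · right
    -- Here `x ^ N - x ^ N * e` lies in `I` and `e` kills `B`, so `1 - x ^ N` is invertible on the
    -- corner, and it is a multiple of `1 - x`.
    have hx : x ^ N - x ^ N * (x ^ N * y ^ N) ∈ I := by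
      rw [← Ideal.Quotient.eq_zero_iff_mem]
      simp only [map_sub, map_mul, map_pow]
      linear_combination -h3
    obtain ⟨u, hu⟩ := hunit (x ^ N - x ^ N * (x ^ N * y ^ N) - x ^ N * (e - x ^ N * y ^ N))
      (I.sub_mem hx (I.mul_mem_left _ hed))
    refine ⟨(∑ i ∈ range N, x ^ i) * u, ?_⟩
    have hg := mul_neg_geom_sum x N
    linear_combination u * B * hg + B * hu - u * x ^ N * h
  · left
    obtain ⟨u, hu⟩ := hunit (e - x ^ N * y ^ N) hed
    refine ⟨x ^ n * y ^ N * u, ?_⟩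
    rw [hN] at *
    linear_combination B * hu + u * h

/-- Nonunits of a local ring are closed under addition: after scaling, the two summands become `x *
u` and `1 - x * u` on the corner. -/
theorem exists_mul_eq_of_add (I : Ideal Z) [HenselianRing Z I]
    [IsArtinianRing (Z ⧸ I)] {B : Z} (hB : ∀ e : Z, e * e = e → e * B = 0 ∨ e * B = B) {x y : Z}
    (h : ∃ u, (x + y) * u * B = B) : (∃ u, x * u * B = B) ∨ ∃ u, y * u * B = B := by
  obtain ⟨u, hu⟩ := h
  rcases exists_mul_eq_or_exists_one_sub_mul_eq I hB (x * u) with ⟨v, hv⟩ | ⟨v, hv⟩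
  · exact .inl ⟨u * v, by linear_combination hv⟩
  · refine .inr ⟨u * v, ?_⟩
    linear_combination hv + v * hu

end LocalIdempotent

end

/-! ### Conjugation and relative traces in the group ring. -/

section

open Finset

namespace BlockTheory

section GroupRing

variable {R : Type*} [CommRing R] {G : Type*} [Group G]

theorem coeff_conj (g : G) (a : MonoidAlgebra R G) (y : G) :
    (conj g a).coeff y = a.coeff (g⁻¹ * y * g) := by
  simp [conj, MonoidAlgebra.of_apply, mul_assoc]

theorem coeff_mul_eq_sum [Fintype G] (a b : MonoidAlgebra R G) (g : G) :
    (a * b).coeff g = ∑ x, a.coeff x * b.coeff (x⁻¹ * g) := by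
  classical
  rw [MonoidAlgebra.coeff_mul, Finsupp.sum_fintype _ _ (by simp)]
  refine Finset.sum_congr rfl fun x _ => ?_
  rw [Finsupp.sum_fintype _ _ (by simp), Finset.sum_eq_single (x⁻¹ * g)]
  · simp
  · intro y _ hy
    rw [if_neg]
    rintro rfl
    simp at hy
  · simp

theorem conj_one (a : MonoidAlgebra R G) : conj 1 a = a := by
  ext y; simp [coeff_conj]

theorem conj_mul_mul (g : G) (a b : MonoidAlgebra R G) : conj g (a * b) = conj g a * conj g b := by
  simp only [conj, ← mul_assoc]
  congr 1
  rw [mul_assoc (MonoidAlgebra.of R G g * a), ← map_mul, inv_mul_cancel, map_one, mul_one]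

theorem conj_add (g : G) (a b : MonoidAlgebra R G) : conj g (a + b) = conj g a + conj g b := by
  ext y; simp [coeff_conj]

theorem conj_of_central {z : MonoidAlgebra R G} (hz : ∀ a, z * a = a * z) (g : G) :
    conj g z = z := by
  rw [conj, ← hz, mul_assoc, ← map_mul, mul_inv_cancel, map_one, mul_one]

theorem central_of_conj {z : MonoidAlgebra R G} (hz : ∀ g, conj g z = z)
    (a : MonoidAlgebra R G) : z * a = a * z := by
  induction a using MonoidAlgebra.induction_on with
  | of g =>
    conv_rhs => rw [← hz g⁻¹]
    rw [conj, inv_inv, ← mul_assoc, ← mul_assoc, ← map_mul, mul_inv_cancel, map_one, one_mul]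
  | add a b ha hb => rw [mul_add, add_mul, ha, hb]
  | smul r a ha => rw [mul_smul_comm, smul_mul_assoc, ha]

theorem coeff_relTrace [Fintype G] (P : Subgroup G) [Fintype (G ⧸ P)] (a : MonoidAlgebra R G)
    (y : G) :
    (relTrace P a).coeff y = ∑ x : G ⧸ P, a.coeff (x.out⁻¹ * y * x.out) := by
  rw [relTrace, finsum_eq_sum_of_fintype, MonoidAlgebra.coeff_sum, Finsupp.finsetSum_apply]
  simp [coeff_conj]

theorem isFixedBy_iff (P : Subgroup G) (a : MonoidAlgebra R G) :
    IsFixedBy P a ↔ ∀ g ∈ P, ∀ y, a.coeff (g⁻¹ * y * g) = a.coeff y := by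
  refine forall₂_congr fun g _ => ⟨fun h y => ?_, fun h => ?_⟩
  · rw [← coeff_conj, h]
  · ext y
    rw [coeff_conj, h]

theorem IsFixedBy.coeff_conj_eq {P : Subgroup G} {a : MonoidAlgebra R G} (ha : IsFixedBy P a)
    {x x' : G} (h : (x : G ⧸ P) = x') (y : G) :
    a.coeff (x⁻¹ * y * x) = a.coeff (x'⁻¹ * y * x') := by
  rw [QuotientGroup.eq] at h
  rw [← (isFixedBy_iff P a).1 ha _ h]
  group

theorem IsFixedBy.coeff_out {P : Subgroup G} {a : MonoidAlgebra R G} (ha : IsFixedBy P a)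
    (x y : G) : a.coeff ((x : G ⧸ P).out⁻¹ * y * (x : G ⧸ P).out) = a.coeff (x⁻¹ * y * x) :=
  ha.coeff_conj_eq (by simp) y

variable [Finite G]

theorem conj_relTrace {P : Subgroup G} {a : MonoidAlgebra R G} (ha : IsFixedBy P a) (g : G) :
    conj g (relTrace P a) = relTrace P a := by
  have := Fintype.ofFinite G
  have := Fintype.ofFinite (G ⧸ P)
  ext y
  rw [coeff_conj, coeff_relTrace, coeff_relTrace]
  refine Fintype.sum_equiv (MulAction.toPerm g) _ _ fun x => ?_
  induction x using QuotientGroup.induction_on with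
  | H x =>
    rw [MulAction.toPerm_apply, MulAction.Quotient.smul_coe, smul_eq_mul, ha.coeff_out,
      ha.coeff_out]
    congr 1
    group

theorem relTrace_central {P : Subgroup G} {a : MonoidAlgebra R G} (ha : IsFixedBy P a)
    (c : MonoidAlgebra R G) : relTrace P a * c = c * relTrace P a :=
  central_of_conj (conj_relTrace ha) c

theorem relTrace_add (P : Subgroup G) (a b : MonoidAlgebra R G) :
    relTrace P (a + b) = relTrace P a + relTrace P b := by
  have := Fintype.ofFinite G
  have := Fintype.ofFinite (G ⧸ P)
  ext y
  simp [coeff_relTrace, Finset.sum_add_distrib]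

theorem relTrace_smul (P : Subgroup G) (r : R) (a : MonoidAlgebra R G) :
    relTrace P (r • a) = r • relTrace P a := by
  have := Fintype.ofFinite G
  have := Fintype.ofFinite (G ⧸ P)
  ext y
  simp [coeff_relTrace, Finset.mul_sum]

theorem relTrace_mul (P : Subgroup G) {z : MonoidAlgebra R G} (hz : ∀ a, z * a = a * z)
    (a : MonoidAlgebra R G) : relTrace P (z * a) = z * relTrace P a := by
  have := Fintype.ofFinite (G ⧸ P)
  simp only [relTrace, finsum_eq_sum_of_fintype, conj_mul_mul, conj_of_central hz,
    Finset.mul_sum]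

/-- The class sum of the orbit of `g` under a subgroup `D` is, after taking traces, the trace of
`g` from the centralizer of `g` in `D`. -/
theorem relTrace_orbitSum {D Q : Subgroup G} {g : G} (hQ : ∀ e, e ∈ Q ↔ e ∈ D ∧ e * g = g * e)
    {K : MonoidAlgebra R G} [DecidablePred fun y => ∃ d ∈ D, d * g * d⁻¹ = y]
    (hK : ∀ y, K.coeff y = if ∃ d ∈ D, d * g * d⁻¹ = y then 1 else 0) :
    relTrace D K = relTrace Q (MonoidAlgebra.single g 1) := by
  classical
  have := Fintype.ofFinite G
  have := Fintype.ofFinite (G ⧸ D)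
  have := Fintype.ofFinite (G ⧸ Q)
  ext y
  simp only [coeff_relTrace, hK, MonoidAlgebra.coeff_single, Finsupp.single_apply]
  rw [Finset.sum_boole, Finset.sum_boole]
  congr 1
  symm
  have key : ∀ x : G, g = x⁻¹ * y * x ↔ x * g * x⁻¹ = y := fun x => by
    rw [mul_inv_eq_iff_eq_mul, mul_assoc x⁻¹, eq_inv_mul_iff_mul_eq]
  refine Finset.card_bij (fun (x : G ⧸ Q) _ => (x.out : G ⧸ D)) ?_ ?_ ?_
  · intro x hx
    simp only [mem_filter, mem_univ, true_and, key] at hx ⊢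
    have h : ((x.out : G ⧸ D).out : G ⧸ D) = (x.out : G ⧸ D) := by simp
    rw [QuotientGroup.eq] at h
    refine ⟨_, h, ?_⟩
    rw [← hx]
    group
  · intro x hx x' hx' h
    simp only [mem_filter, mem_univ, true_and, key] at hx hx'
    rw [← QuotientGroup.out_eq' x, ← QuotientGroup.out_eq' x', QuotientGroup.eq, hQ]
    refine ⟨QuotientGroup.eq.1 h, ?_⟩
    calc x.out⁻¹ * x'.out * g = x.out⁻¹ * (x'.out * g * x'.out⁻¹) * x'.out := by group
      _ = _ := by rw [hx', ← hx]; group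
  · intro x hx
    simp only [mem_filter, mem_univ, true_and] at hx
    obtain ⟨d, hd, hdg⟩ := hx
    obtain ⟨⟨e, he'⟩, hh⟩ := QuotientGroup.mk_out_eq_mul Q (x.out * d)
    obtain ⟨he, heg⟩ := (hQ e).1 he'
    refine ⟨((x.out * d : G) : G ⧸ Q), ?_, ?_⟩
    · simp only [mem_filter, mem_univ, true_and, key]
      rw [hh]
      calc x.out * d * e * g * (x.out * d * e)⁻¹ = x.out * d * (e * g) * (x.out * d * e)⁻¹ := by
            group
        _ = x.out * (d * g * d⁻¹) * x.out⁻¹ := by rw [heg]; group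
        _ = y := by rw [hdg]; group
    · conv_rhs => rw [← QuotientGroup.out_eq' x]
      rw [hh, eq_comm, QuotientGroup.eq, mul_assoc, inv_mul_cancel_left]
      exact D.mul_mem hd he

/-- On the elements centralized by the `2`-group `D`, the coefficients mod `2` are multiplicative
for `D`-fixed elements. -/
theorem two_dvd_coeff_mul {D : Subgroup G} (hD : IsPGroup 2 D) {a b : MonoidAlgebra R G}
    (ha : IsFixedBy D a) (hb : IsFixedBy D b)
    (h : ∀ g, (∀ d ∈ D, d * g = g * d) → 2 ∣ a.coeff g) (g : G) (hg : ∀ d ∈ D, d * g = g * d) :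
    2 ∣ (a * b).coeff g := by
  have := Fintype.ofFinite G
  rw [coeff_mul_eq_sum]
  -- The coefficient at `g` is a sum over factorizations `x * (x⁻¹ * g)`. Conjugation by `D`
  -- permutes them, and only those with `x` centralized by `D` matter modulo `2`.
  let _ : MulAction D G := MulAction.compHom G (MulAut.conj.comp D.subtype)
  have hs : ∀ (d : D) (x : G), d • x = d * x * (d : G)⁻¹ := fun d x => rfl
  refine hD.two_dvd_sum_of_two_dvd_fixedPoints _ (fun d x => ?_) fun x hx => ?_
  · rw [isFixedBy_iff] at ha hb
    rw [← ha d d.2, ← hb d d.2, hs]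
    have := hg d d.2
    congr 2
    · group
    · calc _ = x⁻¹ * ((d : G)⁻¹ * (g * d)) := by group
        _ = _ := by rw [← this]; group
  · refine Dvd.dvd.mul_right (h x fun d hd => ?_) _
    have := hx ⟨d, hd⟩
    rw [hs] at this
    exact mul_inv_eq_iff_eq_mul.1 this

end GroupRing

end BlockTheory

end

/-! ### The centre of the group ring is `2`-adically complete with Artinian reduction. -/

section

open Finset

theorem sModEq_span_two_pow_iff {A : Type*} [CommRing A] (x y : A) (n : ℕ) :
    x ≡ y [SMOD (Ideal.span {(2 : A)} ^ n • ⊤ : Submodule A A)] ↔ 2 ^ n ∣ x - y := by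
  rw [SModEq.sub_mem, smul_eq_mul, Ideal.mul_top, Ideal.span_singleton_pow,
    Ideal.mem_span_singleton]

theorem eq_zero_of_forall_two_pow_dvd {R : Type*} [CommRing R]
    [IsHausdorff (Ideal.span {(2 : R)}) R] {r : R} (h : ∀ n, 2 ^ n ∣ r) : r = 0 :=
  IsHausdorff.haus (I := Ideal.span {(2 : R)}) ‹_› r fun n =>
    (sModEq_span_two_pow_iff r 0 n).2 (by simpa using h n)

/-- Limits are formed coordinate by coordinate; `hlim` says that the image of `Z` is closed, so that
the limit is again in `Z`. -/
theorem isAdicComplete_of_coordinates {R Z Y : Type*} [CommRing R] [CommRing Z]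
    [IsAdicComplete (Ideal.span {(2 : R)}) R] (c : Z →+ (Y → R)) (hc : Function.Injective c)
    (hdvd : ∀ (n : ℕ) (z : Z), 2 ^ n ∣ z ↔ ∀ y, 2 ^ n ∣ c z y)
    (hlim : ∀ l : Y → R, (∀ n : ℕ, ∃ z, ∀ y, 2 ^ n ∣ c z y - l y) → ∃ z, c z = l) :
    IsAdicComplete (Ideal.span {(2 : Z)}) Z where
  haus' z hz := by
    refine hc ?_
    rw [map_zero]
    funext y
    refine eq_zero_of_forall_two_pow_dvd fun n => ?_
    have := (sModEq_span_two_pow_iff z 0 n).1 (hz n)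
    rw [sub_zero] at this
    exact (hdvd n z).1 this y
  prec' f hf := by
    have h1 : ∀ {m n} (_ : m ≤ n) (y : Y), 2 ^ m ∣ c (f m) y - c (f n) y := fun {m n} hmn y => by
      have := (hdvd m _).1 ((sModEq_span_two_pow_iff _ _ _).1 (hf hmn)) y
      rwa [map_sub] at this
    have h2 : ∀ y, ∃ l : R, ∀ n, 2 ^ n ∣ c (f n) y - l := fun y => by
      obtain ⟨l, hl⟩ := IsPrecomplete.prec (I := Ideal.span {(2 : R)}) (M := R) inferInstance
        (f := fun n => c (f n) y) fun hmn => (sModEq_span_two_pow_iff _ _ _).2 (h1 hmn y)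
      exact ⟨l, fun n => (sModEq_span_two_pow_iff _ _ _).1 (hl n)⟩
    choose l hl using h2
    obtain ⟨z, rfl⟩ := hlim l fun n => ⟨f n, fun y => hl y n⟩
    refine ⟨z, fun n => (sModEq_span_two_pow_iff _ _ _).2 ((hdvd n _).2 fun y => ?_)⟩
    rw [map_sub]
    exact hl y n

theorem isArtinianRing_quotient_span_two (R Z : Type*) [CommRing R] [CommRing Z] [Algebra R Z]
    [Module.Finite R Z] [IsArtinianRing (R ⧸ Ideal.span {(2 : R)})] :
    IsArtinianRing (Z ⧸ Ideal.span {(2 : Z)}) := by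
  let φ : R →+* Z ⧸ Ideal.span {(2 : Z)} := (Ideal.Quotient.mk _).comp (algebraMap R Z)
  have hφ : φ.Finite := RingHom.Finite.comp
    (RingHom.Finite.of_surjective _ Ideal.Quotient.mk_surjective) (RingHom.finite_algebraMap.2 ‹_›)
  let ψ : R ⧸ Ideal.span {(2 : R)} →+* Z ⧸ Ideal.span {(2 : Z)} :=
    Ideal.Quotient.lift _ φ fun a ha => by
      obtain ⟨c, rfl⟩ := Ideal.mem_span_singleton.1 ha
      have : φ 2 = 0 := by
        change Ideal.Quotient.mk _ (algebraMap R Z 2) = 0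
        rw [Ideal.Quotient.eq_zero_iff_mem, map_ofNat]
        exact Ideal.mem_span_singleton_self _
      rw [map_mul, this, zero_mul]
  have hψ : ψ.Finite := by
    refine RingHom.Finite.of_comp_finite (f := Ideal.Quotient.mk (Ideal.span {(2 : R)})) ?_
    have : ψ.comp (Ideal.Quotient.mk (Ideal.span {(2 : R)})) = φ := by
      ext; simp [ψ]
    rwa [this]
  algebraize [ψ]
  exact IsArtinianRing.of_finite (R ⧸ Ideal.span {(2 : R)}) _


namespace BlockTheory

section Center

variable {R : Type*} [CommRing R] {G : Type*} [Group G]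

theorem mem_center_iff_coeff {z : MonoidAlgebra R G} :
    z ∈ Subalgebra.center R (MonoidAlgebra R G) ↔
      ∀ g y, z.coeff (g⁻¹ * y * g) = z.coeff y := by
  rw [Subalgebra.mem_center_iff]
  constructor
  · intro h g y
    rw [← coeff_conj, conj_of_central (fun a => (h a).symm)]
  · intro h a
    refine (central_of_conj (fun g => ?_) a).symm
    ext y
    rw [coeff_conj, h]

theorem two_pow_mul_eq_smul {A : Type*} [Semiring A] [Algebra R A] (n : ℕ) (a : A) :
    2 ^ n * a = (2 ^ n : R) • a := by
  rw [Algebra.smul_def, map_pow, map_ofNat]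

/-- Dividing the coefficients by `2 ^ n` keeps the element central, because `R` has no `2`-torsion.
-/
theorem two_pow_dvd_iff_coeff [IsDomain R] [CharZero R] [Finite G] (n : ℕ)
    (z : Subalgebra.center R (MonoidAlgebra R G)) : 2 ^ n ∣ z ↔ ∀ y, 2 ^ n ∣ z.1.coeff y := by
  constructor
  · rintro ⟨w, rfl⟩ y
    rw [two_pow_mul_eq_smul (R := R), Subalgebra.coe_smul, MonoidAlgebra.coeff_smul_apply,
      smul_eq_mul]
    exact dvd_mul_right _ _
  · intro h
    choose u hu using h
    have h2 : (2 ^ n : R) ≠ 0 := pow_ne_zero _ two_ne_zero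
    let w : MonoidAlgebra R G := MonoidAlgebra.ofCoeff (Finsupp.equivFunOnFinite.symm u)
    have hw : ∀ y, w.coeff y = u y := fun y => rfl
    refine ⟨⟨w, mem_center_iff_coeff.2 fun g y => ?_⟩, ?_⟩
    · rw [hw, hw]
      refine mul_left_cancel₀ h2 ?_
      rw [← hu, ← hu]
      exact mem_center_iff_coeff.1 z.2 g y
    · rw [two_pow_mul_eq_smul (R := R)]
      ext y
      rw [Subalgebra.coe_smul, MonoidAlgebra.coeff_smul_apply, hw, hu, smul_eq_mul]

/-- Being constant on conjugacy classes is a closed condition on coefficients, so the centre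
inherits adic completeness from `R`, and complete pairs are Henselian. -/
theorem henselianRing_center [IsDomain R] [CharZero R] [Finite G]
    [IsAdicComplete (Ideal.span {(2 : R)}) R] :
    HenselianRing (Subalgebra.center R (MonoidAlgebra R G))
      (Ideal.span {(2 : Subalgebra.center R (MonoidAlgebra R G))}) := by
  refine @IsAdicComplete.henselianRing _ _ _ (isAdicComplete_of_coordinates (R := R) (Y := G)
    { toFun := fun z y => z.1.coeff y, map_zero' := rfl, map_add' := fun _ _ => rfl }
    (fun z w h => ?_) (fun n z => two_pow_dvd_iff_coeff n z) fun l hl => ?_)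
  · ext y
    exact congrFun h y
  · let w : MonoidAlgebra R G := MonoidAlgebra.ofCoeff (Finsupp.equivFunOnFinite.symm l)
    have hw : ∀ y, w.coeff y = l y := fun y => rfl
    refine ⟨⟨w, mem_center_iff_coeff.2 fun g y => ?_⟩, rfl⟩
    rw [hw, hw, ← sub_eq_zero]
    refine eq_zero_of_forall_two_pow_dvd fun n => ?_
    obtain ⟨z, hz⟩ := hl n
    have h3 := dvd_sub (hz y) (hz (g⁻¹ * y * g))
    change 2 ^ n ∣ (z.1.coeff y - _) - (z.1.coeff _ - _) at h3
    rw [mem_center_iff_coeff.1 z.2] at h3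
    simpa using h3

theorem isArtinianRing_center_quotient [IsNoetherianRing R] [Finite G]
    [IsArtinianRing (R ⧸ Ideal.span {(2 : R)})] :
    IsArtinianRing (Subalgebra.center R (MonoidAlgebra R G) ⧸
      Ideal.span {(2 : Subalgebra.center R (MonoidAlgebra R G))}) := by
  have hf : Module.Finite R (MonoidAlgebra R G) :=
    Module.Finite.equiv (MonoidAlgebra.coeffLinearEquiv R : MonoidAlgebra R G ≃ₗ[R] _).symm
  have hZ : Module.Finite R (Subalgebra.center R (MonoidAlgebra R G)) :=
    Module.IsNoetherian.finite R (Subalgebra.toSubmodule (Subalgebra.center R (MonoidAlgebra R G)))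
  exact isArtinianRing_quotient_span_two R _

end Center

end BlockTheory

end

/-! ### Brauer construct of a block, covering blocks, and the element `x₀`. -/

section

open Finset

namespace BlockTheory

section Brauer

variable {R : Type*} [CommRing R] {G : Type*} [Group G]

theorem IsBlock.mul_comm' {B : MonoidAlgebra R G} (hB : IsBlock B) (a : MonoidAlgebra R G) :
    B * a = a * B :=
  (Subring.mem_center_iff.1 hB.central a).symm

variable [IsDomain R] [CharZero R] [IsNoetherianRing R] [IsAdicComplete (Ideal.span {(2 : R)}) R]
  [IsArtinianRing (R ⧸ Ideal.span {(2 : R)})] [Finite G]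

/-- The Brauer construct of a block at a defect group does not vanish: some coefficient at an
element centralized by the defect group is odd. -/
theorem IsDefectGroup.exists_not_two_dvd_coeff {B : MonoidAlgebra R G} (hB : IsBlock B)
    {D : Subgroup G} (hD : IsDefectGroup B D) (hp : IsPGroup 2 D) :
    ∃ g, (∀ d ∈ D, d * g = g * d) ∧ ¬ 2 ∣ B.coeff g := by
  classical
  obtain ⟨⟨A, hA, hAB⟩, hmin⟩ := hD
  by_contra! hcon
  let Z := Subalgebra.center R (MonoidAlgebra R G)
  have : HenselianRing Z (Ideal.span {(2 : Z)}) := henselianRing_center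
  have : IsArtinianRing (Z ⧸ Ideal.span {(2 : Z)}) := isArtinianRing_center_quotient
  let Bz : Z := ⟨B, Subalgebra.mem_center_iff.2 fun a => (hB.mul_comm' a).symm⟩
  have hBz : Bz * Bz = Bz := Subtype.ext hB.idem
  have hBz0 : Bz ≠ 0 := fun h => hB.ne_zero (congrArg Subtype.val h)
  have hprim : ∀ e : Z, e * e = e → e * Bz = 0 ∨ e * Bz = Bz := by
    intro e he
    have h1 : (e * Bz) * (e * Bz) = e * Bz := by
      calc _ = (e * e) * (Bz * Bz) := by ring
        _ = _ := by rw [he, hBz]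
    have h2 : Bz * (e * Bz) = e * Bz := by
      calc _ = e * (Bz * Bz) := by ring
        _ = _ := by rw [hBz]
    rcases hB.primitive (e * Bz : Z) (congrArg Subtype.val h1)
      (Subring.mem_center_iff.2 (Subalgebra.mem_center_iff.1 (e * Bz).2))
      (congrArg Subtype.val h2) with h | h
    · exact .inl (Subtype.ext h)
    · exact .inr (Subtype.ext h)
  have hzero : ¬ ∃ u, 0 * u * Bz = Bz := by
    rintro ⟨u, hu⟩
    exact hBz0 (by rw [← hu]; ring)
  -- A multiple of `2` acting invertibly on the corner would make `B` divisible by every power of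
  -- `2`, hence zero.
  have htwo : ∀ w, ¬ ∃ u, 2 * w * u * Bz = Bz := by
    rintro w ⟨u, hu⟩
    have hn : ∀ n : ℕ, (2 * w * u) ^ n * Bz = Bz := by
      intro n
      induction n with
      | zero => simp
      | succ n ih => rw [pow_succ, mul_assoc, hu, ih]
    refine hB.ne_zero ?_
    ext y
    refine eq_zero_of_forall_two_pow_dvd fun n => ?_
    refine (two_pow_dvd_iff_coeff n Bz).1 ?_ y
    rw [← hn n, mul_assoc 2, mul_pow, mul_assoc]
    exact dvd_mul_right _ _
  let T : ∀ (Q : Subgroup G) (a : MonoidAlgebra R G), IsFixedBy Q a → Z := fun Q a ha =>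
    ⟨relTrace Q a, Subalgebra.mem_center_iff.2 fun c => (relTrace_central ha c).symm⟩
  -- A trace from `Q < D` acting invertibly on the corner would exhibit `B` itself as a trace from
  -- `Q`, against the minimality of `D`.
  have htrace : ∀ (Q : Subgroup G) (a : MonoidAlgebra R G) (ha : IsFixedBy Q a), Q < D →
      ¬ ∃ u, T Q a ha * u * Bz = Bz := by
    rintro Q a ha hQ ⟨u, hu⟩
    have hc : ∀ c, (u * Bz : Z).1 * c = c * (u * Bz : Z).1 := fun c =>
      (Subalgebra.mem_center_iff.1 (u * Bz).2 c).symm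
    refine hQ.not_ge (hmin ⟨(u * Bz : Z).1 * a, fun g hg => ?_, ?_⟩ hQ.le)
    · rw [conj_mul_mul, conj_of_central hc, ha g hg]
    · rw [relTrace_mul _ hc, hc]
      rw [mul_assoc] at hu
      exact congrArg Subtype.val hu
  -- Induction on the support, removing one `D`-orbit sum at a time. The trace of an orbit sum comes
  -- from a proper subgroup of `D` unless the orbit is a single point, and then its coefficient is
  -- even. As the corner is local, a sum of nonunits never becomes a unit.
  have main : ∀ (n : ℕ) (E : MonoidAlgebra R G) (hE : IsFixedBy D E),
      (∀ g, (∀ d ∈ D, d * g = g * d) → 2 ∣ E.coeff g) → #E.coeff.support ≤ n →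
      ¬ ∃ u, T D E hE * u * Bz = Bz := by
    intro n
    induction n with
    | zero =>
      intro E hE _ hn
      have : E = 0 := by
        rw [Nat.le_zero, Finset.card_eq_zero, Finsupp.support_eq_empty] at hn
        exact MonoidAlgebra.coeff_eq_zero.1 hn
      have h0 : T D E hE = 0 := by
        refine Subtype.ext ?_
        change relTrace D E = 0
        rw [this, ← zero_smul R (0 : MonoidAlgebra R G), relTrace_smul, zero_smul, zero_smul]
      rwa [h0]
    | succ n ih =>
      intro E hE hE2 hn
      by_cases hE0 : E = 0
      · exact ih E hE hE2 (by simp [hE0])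
      obtain ⟨g, hg⟩ : E.coeff.support.Nonempty := by
        rw [Finsupp.support_nonempty_iff]
        exact fun h => hE0 (MonoidAlgebra.coeff_eq_zero.1 h)
      rw [Finsupp.mem_support_iff] at hg
      have hEf := (isFixedBy_iff D E).1 hE
      let K : MonoidAlgebra R G := MonoidAlgebra.ofCoeff (Finsupp.equivFunOnFinite.symm
        fun y => if ∃ d ∈ D, d * g * d⁻¹ = y then 1 else 0)
      have hK : ∀ y, K.coeff y = if ∃ d ∈ D, d * g * d⁻¹ = y then 1 else 0 := fun y => rfl
      have hKE : ∀ y, K.coeff y = 0 ∨ (K.coeff y = 1 ∧ E.coeff y = E.coeff g) := by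
        intro y
        rw [hK]
        split_ifs with h
        · obtain ⟨d, hd, rfl⟩ := h
          refine .inr ⟨rfl, ?_⟩
          rw [← hEf d hd]
          congr 1
          group
        · exact .inl rfl
      have hKf : IsFixedBy D K := by
        rw [isFixedBy_iff]
        intro d hd y
        rw [hK, hK]
        refine if_congr ⟨?_, ?_⟩ rfl rfl
        · rintro ⟨e, he, h⟩
          refine ⟨d * e, D.mul_mem hd he, ?_⟩
          calc d * e * g * (d * e)⁻¹ = d * (e * g * e⁻¹) * d⁻¹ := by group
            _ = y := by rw [h]; group
        · rintro ⟨e, he, h⟩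
          refine ⟨d⁻¹ * e, D.mul_mem (D.inv_mem hd) he, ?_⟩
          rw [← h]
          group
      have hKs : ∀ r : R, IsFixedBy D (r • K) := by
        intro r
        rw [isFixedBy_iff] at hKf ⊢
        intro d hd y
        rw [MonoidAlgebra.coeff_smul_apply, MonoidAlgebra.coeff_smul_apply, hKf d hd]
      let E' := E + (-E.coeff g) • K
      have hE'c : ∀ y, E'.coeff y = E.coeff y - E.coeff g * K.coeff y := by
        intro y
        simp [E', sub_eq_add_neg]
      have hE'f : IsFixedBy D E' := by
        intro d hd
        rw [conj_add, hE d hd, hKs _ d hd]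
      have hE'2 : ∀ y, (∀ d ∈ D, d * y = y * d) → 2 ∣ E'.coeff y := by
        intro y hy
        rw [hE'c]
        rcases hKE y with h | ⟨-, h⟩
        · rw [h, mul_zero, sub_zero]
          exact hE2 y hy
        · rw [← h]
          exact dvd_sub (hE2 y hy) ((hE2 y hy).mul_right _)
      have hE's : #E'.coeff.support ≤ n := by
        refine Nat.le_of_lt_succ (lt_of_lt_of_le (Finset.card_lt_card ?_) hn)
        refine (Finset.ssubset_iff_of_subset fun y hy => ?_).2 ⟨g, ?_, ?_⟩
        · rw [Finsupp.mem_support_iff, hE'c] at hy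
          rw [Finsupp.mem_support_iff]
          rcases hKE y with h | ⟨-, h⟩
          · simpa [h] using hy
          · rwa [h]
        · rwa [Finsupp.mem_support_iff]
        · rw [Finsupp.mem_support_iff, not_not, hE'c, hK, if_pos ⟨1, D.one_mem, by simp⟩]
          simp
      have hsum : T D E hE = T D E' hE'f + T D (E.coeff g • K) (hKs _) := by
        refine Subtype.ext ?_
        change relTrace D E = relTrace D E' + relTrace D (E.coeff g • K)
        rw [← relTrace_add]
        congr 1
        simp [E']
      rw [hsum]
      intro hu
      rcases exists_mul_eq_of_add (Ideal.span {(2 : Z)}) hprim hu with h | h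
      · exact ih E' hE'f hE'2 hE's h
      · let Q : Subgroup G := D ⊓ Subgroup.centralizer {g}
        have hQ : ∀ e, e ∈ Q ↔ e ∈ D ∧ e * g = g * e := fun e => by
          rw [Subgroup.mem_inf, Subgroup.mem_centralizer_singleton_iff, eq_comm]
        by_cases hgD : ∀ d ∈ D, d * g = g * d
        · obtain ⟨c, hc⟩ := hE2 g hgD
          have hck : T D (E.coeff g • K) (hKs _) = 2 * T D (c • K) (hKs _) := by
            have h2 := two_pow_mul_eq_smul (R := R) 1 (T D (c • K) (hKs _))
            rw [pow_one, pow_one] at h2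
            rw [h2]
            refine Subtype.ext ?_
            change relTrace D (E.coeff g • K) = (2 : R) • relTrace D (c • K)
            rw [hc, mul_smul, relTrace_smul]
          rw [hck] at h
          exact htwo _ h
        · have hQD : Q < D := by
            refine lt_of_le_of_ne inf_le_left fun h => hgD fun d hd => ((hQ d).1 ?_).2
            rwa [h]
          have hQf : IsFixedBy Q (E.coeff g • MonoidAlgebra.single g (1 : R)) := by
            rw [isFixedBy_iff]
            intro e he y
            simp only [MonoidAlgebra.coeff_smul_apply, MonoidAlgebra.coeff_single,
              Finsupp.single_apply]
            congr 1
            refine if_congr ?_ rfl rfl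
            rw [mul_assoc, eq_inv_mul_iff_mul_eq, ((hQ e).1 he).2]
            exact mul_left_inj e
          refine htrace Q _ hQf hQD ?_
          convert h using 5
          refine Subtype.ext ?_
          change relTrace Q _ = relTrace D _
          rw [relTrace_smul, relTrace_smul, relTrace_orbitSum hQ hK]
  -- Multiplying `A` by `B` keeps the trace equal to `B` and carries the assumed evenness at
  -- `C_G(D)` over to the element being traced.
  have hBA : IsFixedBy D (B * A) := fun d hd => by
    rw [conj_mul_mul, conj_of_central hB.mul_comm', hA d hd]
  refine main _ (B * A) hBA (fun g hg => two_dvd_coeff_mul hp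
    (fun d _ => conj_of_central hB.mul_comm' d) hA hcon g hg) le_rfl ⟨1, ?_⟩
  refine Subtype.ext ?_
  change relTrace D (B * A) * 1 * B = B
  rw [relTrace_mul _ hB.mul_comm', hAB, mul_one, hB.idem, hB.idem]

end Brauer

section Covering

variable {R : Type*} [CommRing R] {G H : Type*} [Group G] [Group H]

theorem IsBlock.map {e : MonoidAlgebra R H} (he : IsBlock e) (σ : H ≃* H) :
    IsBlock (MonoidAlgebra.mapDomainRingEquiv R σ e) := by
  set φ := MonoidAlgebra.mapDomainRingEquiv R σ
  refine ⟨?_, ?_, ?_, ?_⟩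
  · rw [IsIdempotentElem, ← map_mul, he.idem]
  · rw [Subring.mem_center_iff]
    intro a
    obtain ⟨a, rfl⟩ := φ.surjective a
    rw [← map_mul, ← map_mul, he.mul_comm']
  · rw [Ne, EmbeddingLike.map_eq_zero_iff]
    exact he.ne_zero
  · intro f hf hc hef
    obtain ⟨f, rfl⟩ := φ.surjective f
    rw [← map_mul, EmbeddingLike.apply_eq_iff_eq] at hef
    rcases he.primitive f (φ.injective (by rw [map_mul, hf])) (Subring.mem_center_iff.2 fun a =>
      φ.injective (by rw [map_mul, map_mul, Subring.mem_center_iff.1 hc])) hef with h | h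
    · exact .inl (by rw [h, map_zero])
    · exact .inr (by rw [h])

/-- The product is a central idempotent below both, so primitivity leaves only zero or both. -/
theorem IsBlock.mul_eq_zero_or_eq {e f : MonoidAlgebra R H} (he : IsBlock e) (hf : IsBlock f) :
    e * f = 0 ∨ e = f := by
  have hi : IsIdempotentElem (e * f) := he.idem.mul_of_commute (he.mul_comm' f) hf.idem
  have hc : e * f ∈ Subring.center (MonoidAlgebra R H) := mul_mem he.central hf.central
  have h1 : e * (e * f) = e * f := by rw [← mul_assoc, he.idem]
  have h2 : f * (e * f) = e * f := by rw [he.mul_comm' f, ← mul_assoc, hf.idem]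
  rcases he.primitive _ hi hc h1 with h | h
  · exact .inl h
  rcases hf.primitive _ hi hc h2 with h' | h'
  · exact .inl h'
  · exact .inr (h.symm.trans h')

theorem conj_mapDomain (ι : H →* G) (g : G) (σ : H ≃* H) (hσ : ∀ h, ι (σ h) = g * ι h * g⁻¹)
    (a : MonoidAlgebra R H) :
    conj g (MonoidAlgebra.mapDomainRingHom R ι a) =
      MonoidAlgebra.mapDomainRingHom R ι (MonoidAlgebra.mapDomainRingEquiv R σ a) := by
  induction a using MonoidAlgebra.induction_linear with
  | zero => simp [conj]
  | add a b ha hb => simp only [map_add, conj_add, ha, hb]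
  | single h r =>
    simp [conj, MonoidAlgebra.of_apply, hσ]

variable [IsDomain R] [CharZero R] [IsNoetherianRing R] [IsAdicComplete (Ideal.span {(2 : R)}) R]
  [IsArtinianRing (R ⧸ Ideal.span {(2 : R)})] [Finite G]

/-- A conjugate of the defect group of a block covering `b` centralizes an element at which `b` has
odd coefficient. -/
theorem exists_centralized_not_two_dvd_coeff (ι : H →* G) (hι : Function.Injective ι)
    (κ : G → H ≃* H)
    (hκ : ∀ g h, ι (κ g h) = g * ι h * g⁻¹) {b : MonoidAlgebra R H} (hb : IsBlock b)
    {B : MonoidAlgebra R G} (hB : IsBlock B) (hcov : Covers ι B b) {D : Subgroup G}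
    (hD : IsDefectGroup B D) (hp : IsPGroup 2 D) :
    ∃ (g : G) (x : H), (∀ d ∈ D, (g * d * g⁻¹) * ι x = ι x * (g * d * g⁻¹)) ∧ ¬ 2 ∣ b.coeff x := by
  classical
  have := Fintype.ofFinite G
  set b' := MonoidAlgebra.mapDomainRingHom R ι b with hb'
  let X : Finset (MonoidAlgebra R G) := univ.image fun g => conj g b'
  -- The sum of the distinct conjugates of `b`, which are orthogonal, is a central idempotent of
  -- `RG`; since `B` covers `b`, primitivity gives `β * B = B`. An odd coefficient of `B` at
  -- `C_G(D)` therefore forces one of `β`, and then one of some conjugate of `b`.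
  let β := ∑ c ∈ X, c
  have hX : ∀ {c}, c ∈ X ↔ ∃ g, conj g b' = c := fun {c} => by simp [X]
  have hbX : b' ∈ X := hX.2 ⟨1, conj_one b'⟩
  have hform : ∀ g, conj g b' = MonoidAlgebra.mapDomainRingHom R ι
      (MonoidAlgebra.mapDomainRingEquiv R (κ g) b) := fun g => conj_mapDomain ι g (κ g) (hκ g) b
  have horth : ∀ c ∈ X, ∀ c' ∈ X, c ≠ c' → c * c' = 0 := by
    intro c hc c' hc' hne
    obtain ⟨g, rfl⟩ := hX.1 hc
    obtain ⟨g', rfl⟩ := hX.1 hc'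
    rw [hform, hform] at hne ⊢
    rcases (hb.map (κ g)).mul_eq_zero_or_eq (hb.map (κ g')) with h | h
    · rw [← map_mul, h, map_zero]
    · exact absurd (by rw [h]) hne
  have hidem : ∀ c ∈ X, c * c = c := by
    intro c hc
    obtain ⟨g, rfl⟩ := hX.1 hc
    rw [← conj_mul_mul, hb', ← map_mul, hb.idem]
  have hcβ : ∀ c ∈ X, c * β = c := by
    intro c hc
    rw [Finset.mul_sum, Finset.sum_eq_single_of_mem c hc fun c' hc' h => horth c hc c' hc' h.symm,
      hidem c hc]
  have hββ : β * β = β := by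
    conv_lhs => rw [Finset.sum_mul]
    exact Finset.sum_congr rfl hcβ
  have hconjβ : ∀ g, conj g β = β := by
    intro g
    have : conj g β = ∑ c ∈ X, conj g c := by
      simp only [conj, β, Finset.mul_sum, Finset.sum_mul]
    rw [this]
    refine Finset.sum_bij (fun c _ => conj g c) ?_ ?_ ?_ fun _ _ => rfl
    · intro c hc
      obtain ⟨x, rfl⟩ := hX.1 hc
      exact hX.2 ⟨g * x, conj_mul _ _ _⟩
    · intro c _ c' _ h
      rw [← conj_one c, ← conj_one c', ← inv_mul_cancel g, conj_mul, conj_mul]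
      exact congrArg _ h
    · intro c hc
      obtain ⟨x, rfl⟩ := hX.1 hc
      refine ⟨conj (g⁻¹ * x) b', hX.2 ⟨_, rfl⟩, ?_⟩
      rw [← conj_mul, mul_inv_cancel_left]
  have hβc := central_of_conj hconjβ
  have hβB : β * B = B := by
    have h := hB.primitive (β * B) ((show IsIdempotentElem β from hββ).mul_of_commute (hβc B) hB.idem)
      (mul_mem (Subring.mem_center_iff.2 fun a => (hβc a).symm) hB.central)
      (by rw [hβc, ← mul_assoc, hB.idem])
    refine h.resolve_left fun h0 => hcov ?_
    change B * b' = 0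
    rw [hB.mul_comm', ← hcβ b' hbX, mul_assoc, h0, mul_zero]
  obtain ⟨g₁, hg₁, hg₁'⟩ := hD.exists_not_two_dvd_coeff hB hp
  obtain ⟨g₀, hg₀, hg₀'⟩ : ∃ g, (∀ d ∈ D, d * g = g * d) ∧ ¬ 2 ∣ β.coeff g := by
    by_contra! hcon
    refine hg₁' ?_
    rw [← hβB]
    exact two_dvd_coeff_mul hp (fun d _ => hconjβ d)
      (fun d _ => conj_of_central hB.mul_comm' d) hcon g₁ hg₁
  obtain ⟨c, hc, hcg⟩ : ∃ c ∈ X, ¬ 2 ∣ c.coeff g₀ := by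
    by_contra! hcon
    refine hg₀' ?_
    rw [MonoidAlgebra.coeff_sum, Finsupp.finsetSum_apply]
    exact Finset.dvd_sum hcon
  obtain ⟨g, rfl⟩ := hX.1 hc
  rw [coeff_conj] at hcg
  have hr : g⁻¹ * g₀ * g ∈ Set.range ι := by
    by_contra hr
    refine hcg ?_
    have : b'.coeff (g⁻¹ * g₀ * g) = 0 := Finsupp.mapDomain_of_notMem_range _ _ hr
    rw [this]
    exact dvd_zero 2
  obtain ⟨x, hx⟩ := hr
  refine ⟨g⁻¹, x, fun d hd => ?_, fun h => hcg ?_⟩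
  · rw [hx, inv_inv]
    calc g⁻¹ * d * g * (g⁻¹ * g₀ * g) = g⁻¹ * (d * g₀) * g := by group
      _ = _ := by rw [hg₀ d hd]; group
  · have : b'.coeff (g⁻¹ * g₀ * g) = b.coeff x := by
      rw [← hx]
      exact Finsupp.mapDomain_apply hι _ _
    rwa [this]

end Covering

/-- If `b` is a relative trace from `P` and has odd coefficient at `x`, then `2`-subgroups of the
centralizer of `x` are conjugate to subgroups of `P`. -/
theorem exists_conj_mem_of_not_two_dvd_coeff {R H : Type*} [CommRing R] [Group H] [Finite H]
    {P : Subgroup H} {a : MonoidAlgebra R H} (ha : IsFixedBy P a) {x : H}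
    (hx : ¬ 2 ∣ (relTrace P a).coeff x) {S : Subgroup H} (hS : IsPGroup 2 S)
    (hSx : ∀ s ∈ S, s * x = x * s) : ∃ y : H, ∀ s ∈ S, y⁻¹ * s * y ∈ P := by
  have := Fintype.ofFinite H
  have := Fintype.ofFinite (H ⧸ P)
  by_contra! hcon
  refine hx ?_
  rw [coeff_relTrace]
  refine hS.two_dvd_sum_of_two_dvd_fixedPoints _ (fun s y => ?_) fun y hy => ?_
  · induction y using QuotientGroup.induction_on with
    | H y =>
      rw [show s • (y : H ⧸ P) = ((s * y : H) : H ⧸ P) from rfl, ha.coeff_out, ha.coeff_out]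
      congr 1
      calc (s * y)⁻¹ * x * (s * y) = y⁻¹ * (s : H)⁻¹ * (x * s) * y := by group
        _ = _ := by rw [← hSx s s.2]; group
  · obtain ⟨s, hs, hsP⟩ := hcon y.out
    refine absurd ?_ hsP
    have h : ((s * y.out : H) : H ⧸ P) = (y.out : H ⧸ P) := by
      have := hy ⟨s, hs⟩
      rwa [← QuotientGroup.out_eq' y] at this
    rw [eq_comm, QuotientGroup.eq, ← mul_assoc] at h
    exact h

end BlockTheory

end

/-! ### Symplectic groups and their transvections. -/

/-- The representation `ρ` identifies `H` with the full isometry group of the nondegenerate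
alternating form `ω`. -/
structure IsIsometryRep {F V H : Type*} [Field F] [AddCommGroup V] [Module F V] [Group H]
    (ρ : Representation F H V) (ω : V →ₗ[F] V →ₗ[F] F) : Prop where
  alt : ∀ x, ω x x = 0
  nondeg : ∀ x, (∀ y, ω x y = 0) → x = 0
  injective : Function.Injective ρ
  isometry : ∀ h x y, ω (ρ h x) (ρ h y) = ω x y
  full : ∀ f : V →ₗ[F] V, (∀ x y, ω (f x) (f y) = ω x y) → ∃ h, ρ h = f

/-- Three hyperplanes cannot cover a space over a field with more than three elements. This supplies
vectors in general position throughout. -/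
theorem exists_three_ne_zero {F V : Type*} [Field F] [AddCommGroup V] [Module F V] [Finite F]
    (hF : 3 < Nat.card F) {f g k : V →ₗ[F] F} (hf : f ≠ 0) (hg : g ≠ 0) (hk : k ≠ 0) :
    ∃ x, f x ≠ 0 ∧ g x ≠ 0 ∧ k x ≠ 0 := by
  have h := Submodule.iUnion_ssubset_of_forall_ne_top_of_card_lt (Finset.univ : Finset (Fin 3))
    ![LinearMap.ker f, LinearMap.ker g, LinearMap.ker k] (fun i => by
      fin_cases i <;> simpa [LinearMap.ker_eq_top]) (by
      rw [ENat.card_eq_coe_natCard]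
      simpa using hF)
  obtain ⟨x, -, hx⟩ := Set.exists_of_ssubset h
  simp only [Finset.mem_univ, Set.iUnion_true, Set.mem_iUnion, not_exists] at hx
  exact ⟨x, by simpa using hx 0, by simpa using hx 1, by simpa using hx 2⟩

namespace IsIsometryRep

variable {F V H : Type*} [Field F] [AddCommGroup V] [Module F V] [Group H]
  {ρ : Representation F H V} {ω : V →ₗ[F] V →ₗ[F] F}

theorem ext (hS : IsIsometryRep ρ ω) {g h : H} (hgh : ∀ x, ρ g x = ρ h x) : g = h :=
  hS.injective (LinearMap.ext hgh)

theorem mul_apply (ρ : Representation F H V) (g h : H) (x : V) : ρ (g * h) x = ρ g (ρ h x) := by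
  rw [map_mul, Module.End.mul_apply]

theorem inv_apply_self (ρ : Representation F H V) (g : H) (x : V) : ρ g⁻¹ (ρ g x) = x := by
  rw [← mul_apply, inv_mul_cancel, map_one, Module.End.one_apply]

theorem apply_inv_self (ρ : Representation F H V) (g : H) (x : V) : ρ g (ρ g⁻¹ x) = x := by
  rw [← mul_apply, mul_inv_cancel, map_one, Module.End.one_apply]

theorem neg (hS : IsIsometryRep ρ ω) (x y : V) : ω x y = -ω y x := by
  have h := hS.alt (x + y)
  simp only [map_add, LinearMap.add_apply, hS.alt] at h
  linear_combination h

theorem swap_eq_zero (hS : IsIsometryRep ρ ω) {x y : V} (h : ω x y = 0) : ω y x = 0 := by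
  rw [hS.neg, h, neg_zero]

theorem ne_zero (hS : IsIsometryRep ρ ω) {v : V} (hv : v ≠ 0) : ω v ≠ 0 := fun h =>
  hv (hS.nondeg v fun y => by rw [h, LinearMap.zero_apply])

theorem exists_eq_one (hS : IsIsometryRep ρ ω) {v : V} (hv : v ≠ 0) : ∃ w, ω w v = 1 := by
  obtain ⟨w, hw⟩ : ∃ w, ω w v ≠ 0 := by
    by_contra! h
    exact hv (hS.nondeg v fun y => hS.swap_eq_zero (h y))
  exact ⟨(ω w v)⁻¹ • w, by simp [hw]⟩

/-- A vector orthogonal to `v^⊥` is a multiple of `v`. -/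
theorem exists_eq_smul (hS : IsIsometryRep ρ ω) {v y : V} (hv : v ≠ 0)
    (h : ∀ x, ω x v = 0 → ω y x = 0) : ∃ c : F, y = c • v := by
  obtain ⟨w, hw⟩ := hS.exists_eq_one hv
  refine ⟨-ω y w, sub_eq_zero.1 (hS.nondeg _ fun x => ?_)⟩
  have := h (x - ω x v • w) (by simp [hw])
  simp only [map_sub, map_smul, smul_eq_mul, LinearMap.sub_apply, LinearMap.smul_apply] at this ⊢
  rw [hS.neg v x]
  linear_combination this

theorem exists_tau (hS : IsIsometryRep ρ ω) (v : V) (a : F) :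
    ∃ h, ∀ x, ρ h x = x + (a * ω x v) • v := by
  obtain ⟨h, hh⟩ := hS.full (LinearMap.id + a • (ω.flip v).smulRight v) (fun x y => by
    simp only [LinearMap.add_apply, LinearMap.id_apply, LinearMap.smul_apply,
      LinearMap.smulRight_apply, LinearMap.flip_apply, map_add, map_smul, smul_eq_mul, hS.alt]
    rw [hS.neg v y]
    ring)
  exact ⟨h, fun x => by simp [hh, mul_smul]⟩

/-- The symplectic transvection `x ↦ x + a ω(x, v) v`. -/
noncomputable def tau (hS : IsIsometryRep ρ ω) (v : V) (a : F) : H := (hS.exists_tau v a).choose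

theorem tau_apply (hS : IsIsometryRep ρ ω) (v : V) (a : F) (x : V) :
    ρ (hS.tau v a) x = x + (a * ω x v) • v := (hS.exists_tau v a).choose_spec x

theorem conj_tau (hS : IsIsometryRep ρ ω) (h : H) (v : V) (a : F) :
    h * hS.tau v a * h⁻¹ = hS.tau (ρ h v) a := by
  refine hS.ext fun x => ?_
  rw [mul_apply, mul_apply, tau_apply, tau_apply, map_add, map_smul, apply_inv_self,
    ← hS.isometry h (ρ h⁻¹ x), apply_inv_self]

theorem eq_zero_of_tau_eq_one (hS : IsIsometryRep ρ ω) {v : V} {a : F} (hv : v ≠ 0)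
    (h : hS.tau v a = 1) : a = 0 := by
  obtain ⟨w, hw⟩ := hS.exists_eq_one hv
  have := hS.tau_apply v a w
  rw [h, map_one, Module.End.one_apply, hw, mul_one, left_eq_add, smul_eq_zero] at this
  exact this.resolve_right hv

theorem tau_comm (hS : IsIsometryRep ρ ω) {v w : V} (a b : F) (h : ω v w = 0) :
    hS.tau v a * hS.tau w b = hS.tau w b * hS.tau v a := by
  refine hS.ext fun x => ?_
  simp only [mul_apply, tau_apply, map_add, map_smul, h, hS.swap_eq_zero h]
  module

/-- Evaluate both sides at `v`. Together with `tau_comm`, this makes orthogonality of vectors a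
commutation property of transvections, which group automorphisms preserve. -/
theorem eq_zero_of_tau_comm (hS : IsIsometryRep ρ ω) {v w : V} {a b : F} (ha : a ≠ 0)
    (hb : b ≠ 0) (hv : v ≠ 0) (h : hS.tau v a * hS.tau w b = hS.tau w b * hS.tau v a) :
    ω v w = 0 := by
  by_contra hvw
  have := congrArg (fun g => ρ g v) h
  simp only [mul_apply, tau_apply, map_add, map_smul, hS.alt] at this
  have h2 : (a * (b * ω v w * ω w v)) • v = 0 := by
    have h3 := sub_eq_zero.2 this
    rw [← h3]
    module
  rw [smul_eq_zero, hS.neg w v] at h2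
  rcases h2 with h2 | h2
  · simp_all
  · exact hv h2

/-- A transvection along `w - v` takes `v` to `w` when they are not orthogonal; in general, pass
through a vector orthogonal to neither. -/
theorem exists_apply_eq (hS : IsIsometryRep ρ ω) [Finite F] (hF : 3 < Nat.card F) {v w : V}
    (hv : v ≠ 0) (hw : w ≠ 0) : ∃ h, ρ h v = w := by
  have key : ∀ v w : V, ω v w ≠ 0 → ∃ h, ρ h v = w := by
    intro v w h
    refine ⟨hS.tau (w - v) (ω v w)⁻¹, ?_⟩
    rw [tau_apply, map_sub, hS.alt, sub_zero, inv_mul_cancel₀ h, one_smul, add_sub_cancel]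
  obtain ⟨u, hu, -, hu'⟩ := exists_three_ne_zero hF (hS.ne_zero hv) (hS.ne_zero hv) (hS.ne_zero hw)
  obtain ⟨h, hh⟩ := key v u hu
  obtain ⟨h', hh'⟩ := key u w (by rwa [hS.neg, neg_ne_zero])
  exact ⟨h' * h, by rw [mul_apply, hh, hh']⟩

/-- An isometry is a product of transvections acting trivially on its fixed vectors. -/
theorem mem_closure_tau (hS : IsIsometryRep ρ ω) [Finite F] (hF : 3 < Nat.card F)
    [FiniteDimensional F V] (v₀ : V) (h : H) (hh : ρ h v₀ = v₀) :
    h ∈ Subgroup.closure {g | ∃ u a, ω v₀ u = 0 ∧ g = hS.tau u a} := by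
  set C := Subgroup.closure {g | ∃ u a, ω v₀ u = 0 ∧ g = hS.tau u a}
  let Fix : H → Submodule F V := fun g => LinearMap.ker (ρ g - 1)
  have hFix : ∀ g x, x ∈ Fix g ↔ ρ g x = x := fun g x => by
    simp [Fix, sub_eq_zero]
  have hperp : ∀ g, ρ g v₀ = v₀ → ∀ w, ω v₀ (ρ g w - w) = 0 := fun g hg w => by
    conv_lhs => rw [map_sub, ← hg, hS.isometry, hg]
    exact sub_self _
  -- If some `v` is not orthogonal to its image, the transvection along `ρ g v - v` carries `v` to
  -- `ρ g v` and fixes all that `g` fixes; dividing by it enlarges the fixed space.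
  have step : ∀ g, ρ g v₀ = v₀ → (∃ v, ω v (ρ g v) ≠ 0) →
      ∃ t ∈ C, ρ (t⁻¹ * g) v₀ = v₀ ∧ Fix g < Fix (t⁻¹ * g) := by
    rintro g hg ⟨v, hv⟩
    let u := ρ g v - v
    have hu : ω v u = ω v (ρ g v) := by simp [u, hS.alt]
    let t := hS.tau u (ω v (ρ g v))⁻¹
    have htC : t ∈ C := Subgroup.subset_closure ⟨u, _, hperp g hg v, rfl⟩
    have htv : ρ t v = ρ g v := by
      rw [tau_apply, hu, inv_mul_cancel₀ hv, one_smul, add_sub_cancel]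
    have htx : ∀ x, ρ g x = x → ρ (t⁻¹ * g) x = x := by
      intro x hx
      have hxu : ω x u = 0 := by
        simp only [u, map_sub]
        conv_lhs => rw [← hx, hS.isometry, hx]
        exact sub_self _
      have : ρ t x = x := by rw [tau_apply, hxu, mul_zero, zero_smul, add_zero]
      rw [mul_apply, hx]
      conv_lhs => rw [← this]
      exact inv_apply_self ρ t x
    refine ⟨t, htC, htx v₀ hg, lt_of_le_of_ne (fun x hx => ?_) fun heq => hv ?_⟩
    · exact (hFix _ _).2 (htx x ((hFix _ _).1 hx))
    · have : v ∈ Fix g := by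
        rw [heq, hFix, mul_apply, ← htv, inv_apply_self]
      rw [(hFix _ _).1 this, hS.alt]
  have main : ∀ (n : ℕ) (g : H), ρ g v₀ = v₀ →
      Module.finrank F V ≤ Module.finrank F (Fix g) + n → g ∈ C := by
    intro n
    induction n with
    | zero =>
      intro g hg hn
      have h1 : Fix g = ⊤ := Submodule.eq_top_of_finrank_eq
        (le_antisymm (Submodule.finrank_le _) (by simpa using hn))
      have : g = 1 := hS.ext fun x => by
        rw [map_one, Module.End.one_apply]
        exact (hFix g x).1 (h1 ▸ Submodule.mem_top)
      rw [this]
      exact C.one_mem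
    | succ n ih =>
      intro g hg hn
      have step' : ∀ g', ρ g' v₀ = v₀ → (∃ v, ω v (ρ g' v) ≠ 0) → Fix g ≤ Fix g' → g' ∈ C := by
        intro g' hg' hv hle
        obtain ⟨t, htC, ht, hlt⟩ := step g' hg' hv
        have h1 := Submodule.finrank_lt_finrank_of_lt hlt
        have h2 := Submodule.finrank_mono hle
        have := C.mul_mem htC (ih _ ht (by omega))
        rwa [mul_inv_cancel_left] at this
      by_cases hcase : ∃ v, ω v (ρ g v) ≠ 0
      · exact step' g hg hcase le_rfl
      push Not at hcase
      by_cases hg1 : ∀ w, ρ g w = w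
      · rw [show g = 1 from hS.ext fun x => by rw [map_one, Module.End.one_apply, hg1]]
        exact C.one_mem
      push Not at hg1
      obtain ⟨w, hw⟩ := hg1
      let u := ρ g w - w
      have hu : u ≠ 0 := sub_ne_zero.2 hw
      -- Now every vector is orthogonal to its image under `g`. Multiplying by a transvection along
      -- `u` keeps the fixed vectors, and `v` is chosen with `ω u v` and `ω u (ρ g v)` nonzero, so
      -- that it is not orthogonal to its image under the product.
      obtain ⟨v, hv1, -, hv2⟩ := exists_three_ne_zero hF (hS.ne_zero hu) (hS.ne_zero hu)
        (k := ω (ρ g⁻¹ u)) (hS.ne_zero fun h0 => hu (by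
          rw [← apply_inv_self ρ g u, h0, map_zero]))
      rw [← hS.isometry g, apply_inv_self] at hv2
      let t := hS.tau u 1
      have htC : t ∈ C := Subgroup.subset_closure ⟨u, _, hperp g hg w, rfl⟩
      have htx : ∀ x, ρ g x = x → ρ (t * g) x = x := by
        intro x hx
        have hxu : ω x u = 0 := by
          simp only [u, map_sub]
          conv_lhs => rw [← hx, hS.isometry, hx]
          exact sub_self _
        rw [mul_apply, hx, tau_apply, hxu, mul_zero, zero_smul, add_zero]
      have := step' (t * g) (htx v₀ hg) ⟨v, ?_⟩ fun x hx => (hFix _ _).2 (htx x ((hFix _ _).1 hx))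
      · have h3 := C.mul_mem (C.inv_mem htC) this
        rwa [inv_mul_cancel_left] at h3
      · rw [mul_apply, tau_apply, map_add, map_smul, hcase, smul_eq_mul, zero_add, one_mul,
          hS.neg v u, hS.neg (ρ g v)]
        simp [hv1, hv2]
  exact main (Module.finrank F V) h hh (by omega)

end IsIsometryRep

/-! ### Unipotent radicals: automorphisms permute the transvection subgroups. -/

namespace IsIsometryRep

variable {F V H : Type*} [Field F] [AddCommGroup V] [Module F V] [Group H]
  {ρ : Representation F H V} {ω : V →ₗ[F] V →ₗ[F] F}

/-- The unipotent radical of the stabilizer of `v`, as a subgroup. -/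
def unipotentRadical (ρ : Representation F H V) (ω : V →ₗ[F] V →ₗ[F] F) (v : V) : Subgroup H where
  carrier := {h | ρ h v = v ∧ ∀ x, ω x v = 0 → ∃ c : F, ρ h x = x + c • v}
  one_mem' := ⟨by simp, fun x _ => ⟨0, by simp⟩⟩
  mul_mem' := by
    rintro g h ⟨hg, hg'⟩ ⟨hh, hh'⟩
    refine ⟨by rw [mul_apply, hh, hg], fun x hx => ?_⟩
    obtain ⟨c, hc⟩ := hg' x hx
    obtain ⟨d, hd⟩ := hh' x hx
    exact ⟨c + d, by rw [mul_apply, hd, map_add, map_smul, hg, hc, add_smul]; abel⟩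
  inv_mem' := by
    rintro g ⟨hg, hg'⟩
    have hgi : ρ g⁻¹ v = v := by
      conv_lhs => rw [← hg]
      exact inv_apply_self ρ g v
    refine ⟨hgi, fun x hx => ?_⟩
    obtain ⟨c, hc⟩ := hg' x hx
    refine ⟨-c, ?_⟩
    have := congrArg (ρ g⁻¹) hc
    rw [inv_apply_self, map_add, map_smul, hgi] at this
    rw [neg_smul, ← sub_eq_add_neg, eq_sub_iff_add_eq, ← this]

theorem tau_mem_unipotentRadical (hS : IsIsometryRep ρ ω) (v : V) (a : F) :
    hS.tau v a ∈ unipotentRadical ρ ω v :=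
  ⟨by simp [tau_apply, hS.alt], fun x hx => ⟨0, by simp [tau_apply, hx]⟩⟩

theorem exists_mem_unipotentRadical (hS : IsIsometryRep ρ ω) {v x : V} (hx : ω x v = 0) :
    ∃ h ∈ unipotentRadical ρ ω v,
      ∀ y, ρ h y = y + ω y x • v + ω y v • x + ω y v • v := by
  have key : ∀ y, ρ (hS.tau (x + v) 1 * hS.tau x (-1)) y =
      y + ω y x • v + ω y v • x + ω y v • v := by
    intro y
    simp only [mul_apply, tau_apply, map_add, map_smul, hx, hS.alt]
    module
  refine ⟨_, ⟨?_, fun y hy => ⟨ω y x, ?_⟩⟩, key⟩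
  · rw [key, hS.alt, hS.swap_eq_zero hx]
    simp
  · rw [key, hy]
    simp

/-- Writing `h = 1 + n`, the operator `n` sends `V` into `v^⊥`, that into the line of `v`, and `v`
to zero. So `n ^ 3 = 0`, and in characteristic `p ≥ 3` the `p`-th power is `1`. -/
theorem isPGroup_unipotentRadical (hS : IsIsometryRep ρ ω) (p : ℕ) [Fact p.Prime] [CharP F p]
    (hp : 3 ≤ p) {v : V} (hv : v ≠ 0) : IsPGroup p (unipotentRadical ρ ω v) := by
  rintro ⟨h, hh, hh'⟩
  refine ⟨1, Subtype.ext (hS.ext fun x => ?_)⟩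
  have : Nontrivial V := ⟨⟨v, 0, hv⟩⟩
  have : CharP (Module.End F V) p :=
    charP_of_injective_algebraMap (FaithfulSMul.algebraMap_injective F (Module.End F V)) p
  let n : Module.End F V := ρ h - 1
  have hn : ∀ x, n x = ρ h x - x := fun x => rfl
  have hnv : n v = 0 := by rw [hn, hh, sub_self]
  have h3 : n ^ 3 = 0 := by
    refine LinearMap.ext fun x => ?_
    have h1 : ω (n x) v = 0 := by
      rw [hn, map_sub, LinearMap.sub_apply]
      conv_lhs => enter [1]; rw [← hh, hS.isometry]
      exact sub_self _
    obtain ⟨c, hc⟩ := hh' _ h1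
    have h2 : n (n x) = c • v := by rw [hn (n x), hc]; abel
    change n (n (n x)) = 0
    rw [h2, map_smul, hnv, smul_zero]
  have hp' : n ^ p = 0 := by
    rw [← Nat.add_sub_of_le hp, pow_add, h3, zero_mul]
  have hρ : ρ h = 1 + n := by simp [n]
  have : ρ (h ^ p) = 1 := by
    rw [map_pow, hρ, add_pow_char_of_commute (p := p) (Commute.one_left n), hp', one_pow, add_zero]
  simp [this]

/-- Commuting with the radical forces `g` to be the identity on `v^⊥`: each displacement there is
`-l • v` with `l = -l`, and `2` is invertible. An isometry trivial on a hyperplane `v^⊥` is a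
transvection along `v`. -/
theorem exists_eq_tau (hS : IsIsometryRep ρ ω) (h2 : (2 : F) ≠ 0) {v : V} (hv : v ≠ 0) {g : H}
    (hgv : ρ g v = v) (hg : ∀ n ∈ unipotentRadical ρ ω v, n * g = g * n) :
    ∃ a, g = hS.tau v a := by
  obtain ⟨w, hw⟩ := hS.exists_eq_one hv
  have hfix : ∀ x, ω x v = 0 → ρ g x = x := by
    intro x hx
    obtain ⟨n, hn, hn'⟩ := hS.exists_mem_unipotentRadical hx
    have key : ∀ y, ω (ρ g y) (ρ g x - x) • v + ω (ρ g y) v • (ρ g x - x) = 0 := by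
      intro y
      have h1 : ρ (n * g) y = ρ (g * n) y := by rw [hg n hn]
      have h3 : ω (ρ g y) v = ω y v := by
        conv_lhs => rw [← hgv, hS.isometry]
      rw [mul_apply, mul_apply, hn', hn'] at h1
      simp only [map_add, map_smul, hgv] at h1
      rw [map_sub, hS.isometry, sub_smul, smul_sub]
      rw [h3] at h1 ⊢
      have h4 := sub_eq_zero.2 h1
      rw [← neg_eq_zero, ← h4]
      module
    have h5 := key (ρ g⁻¹ w)
    rw [apply_inv_self, hw, one_smul] at h5
    set l := ω w (ρ g x - x)
    have h6 : ρ g x - x = (-l) • v := by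
      rw [neg_smul]
      exact eq_neg_of_add_eq_zero_right h5
    have h7 : l = -l := by
      conv_lhs => rw [show l = ω w (ρ g x - x) from rfl, h6]
      rw [map_smul, hw, smul_eq_mul, mul_one]
    have h8 : l = 0 := by
      have : 2 * l = 0 := by linear_combination h7
      exact (mul_eq_zero.1 this).resolve_left h2
    rw [h8, neg_zero, zero_smul] at h6
    exact sub_eq_zero.1 h6
  obtain ⟨c, hc⟩ := hS.exists_eq_smul (y := ρ g w - w) hv fun x hx => by
    rw [map_sub, LinearMap.sub_apply]
    conv_lhs => enter [1]; rw [← hfix x hx, hS.isometry]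
    exact sub_self _
  refine ⟨c, hS.ext fun x => ?_⟩
  have h1 := hfix (x - ω x v • w) (by simp [hw])
  rw [map_sub, map_smul, sub_eq_iff_eq_add] at h1
  rw [h1, tau_apply, ← add_sub_cancel w (ρ g w), hc]
  module

/-- Automorphisms of a symplectic group map transvection subgroups to transvection subgroups. -/
theorem exists_map_tau (hS : IsIsometryRep ρ ω) [Finite F] [Finite V] [Finite H]
    (h2 : (2 : F) ≠ 0) {v : V} (hv : v ≠ 0) (σ : MulAut H) :
    ∃ v', v' ≠ 0 ∧ ∀ a, ∃ a', σ (hS.tau v a) = hS.tau v' a' := by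
  obtain ⟨p, hp⟩ := CharP.exists F
  have hp' : Fact p.Prime := ⟨(CharP.char_is_prime_or_zero F p).resolve_right fun h => by
    subst h
    have := CharP.charP_to_charZero F
    exact not_finite F⟩
  have hp3 : 3 ≤ p := by
    refine (Nat.Prime.two_le hp'.1).lt_of_ne fun h => h2 ?_
    subst h
    exact_mod_cast CharP.cast_eq_zero F 2
  obtain ⟨S, hNS⟩ := (hS.isPGroup_unipotentRadical p hp3 hv).exists_le_sylow
  -- The `p`-group `S` has a nonzero fixed vector in `V`; being fixed by the radical, it is a
  -- multiple of `v`.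
  have hSv : ∀ s ∈ S, ρ s v = v := by
    let _ : MulAction S V :=
      { smul := fun s x => ρ (s : H) x
        one_smul := fun x => by change ρ ((1 : S) : H) x = x; simp
        mul_smul := fun s t x => mul_apply ρ (s : H) t x }
    have hdvd : p ∣ Nat.card V := by
      have h1 : addOrderOf v ∣ Nat.card V := addOrderOf_dvd_natCard v
      rwa [addOrderOf_eq_prime (p := p) (by
        rw [← Nat.cast_smul_eq_nsmul F, CharP.cast_eq_zero, zero_smul]) hv] at h1
    obtain ⟨b, hb, hb0⟩ := S.2.exists_fixed_point_of_prime_dvd_card_of_fixed_point V hdvd (a := 0)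
      (fun s => map_zero (ρ (s : H)))
    have hb' : ∀ s ∈ S, ρ s b = b := fun s hs => hb ⟨s, hs⟩
    have hbv : ω b v = 0 := by
      have := hb' _ (hNS (hS.tau_mem_unipotentRadical v 1))
      rw [tau_apply, add_eq_left, one_mul, smul_eq_zero] at this
      exact this.resolve_right hv
    obtain ⟨c, rfl⟩ := hS.exists_eq_smul (y := b) hv fun x hx => by
      obtain ⟨n, hn, hn'⟩ := hS.exists_mem_unipotentRadical hx
      have := hb' n (hNS hn)
      rw [hn', hbv, zero_smul, zero_smul, add_zero, add_zero, add_eq_left, smul_eq_zero] at this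
      exact this.resolve_right hv
    have hc : c ≠ 0 := fun h => hb0 (by rw [h, zero_smul])
    intro s hs
    have := hb' s hs
    rw [map_smul] at this
    exact smul_right_injective V hc this
  obtain ⟨g, hg⟩ := MulAction.exists_smul_eq H S (σ • S)
  have hmem : ∀ x, x ∈ S → ∃ y ∈ S, g * y * g⁻¹ = σ x := by
    intro x hx
    have : σ x ∈ ((σ • S : Sylow p H) : Subgroup H) :=
      Subgroup.smul_mem_pointwise_smul x σ _ hx
    rw [← hg] at this
    obtain ⟨y, hy, h⟩ := Subgroup.mem_smul_pointwise_iff_exists _ _ _ |>.1 this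
    exact ⟨y, hy, h⟩
  have hmem' : ∀ y, y ∈ S → ∃ x ∈ S, g * y * g⁻¹ = σ x := by
    intro y hy
    have : g * y * g⁻¹ ∈ ((g • S : Sylow p H) : Subgroup H) :=
      Subgroup.smul_mem_pointwise_smul y (MulAut.conj g) _ hy
    rw [hg] at this
    obtain ⟨x, hx, h⟩ := Subgroup.mem_smul_pointwise_iff_exists _ _ _ |>.1 this
    exact ⟨x, hx, h.symm⟩
  refine ⟨ρ g v, fun h => hv (by rw [← inv_apply_self ρ g v, h, map_zero]), fun a => ?_⟩
  have htS := hNS (hS.tau_mem_unipotentRadical v a)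
  obtain ⟨y, hy, hyt⟩ := hmem _ htS
  -- The transvection is central in `S`, as `S` fixes `v`. By Sylow, `σ` followed by conjugation by
  -- `g⁻¹` preserves `S`, so the image is again central in `S` and hence commutes with the radical.
  obtain ⟨a', ha'⟩ := hS.exists_eq_tau h2 hv (hSv y hy) fun n hn => by
    obtain ⟨x, hx, hx'⟩ := hmem' n (hNS hn)
    have hcomm : x * hS.tau v a = hS.tau v a * x := by
      have h1 := hS.conj_tau x v a
      rw [hSv x hx] at h1
      rwa [mul_inv_eq_iff_eq_mul] at h1
    have h3 := congrArg σ hcomm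
    rw [map_mul, map_mul, ← hx', ← hyt] at h3
    have h4 : g * (n * y) * g⁻¹ = g * (y * n) * g⁻¹ := by
      simpa only [mul_assoc, inv_mul_cancel_left] using h3
    exact mul_left_cancel (mul_right_cancel h4)
  exact ⟨a', by rw [← hyt, ha', conj_tau]⟩

end IsIsometryRep

/-! ### Automorphisms are semilinear; the linear ones are similitudes. -/

namespace IsIsometryRep

variable {F V H : Type*} [Field F] [AddCommGroup V] [Module F V] [Group H]
  {ρ : Representation F H V} {ω : V →ₗ[F] V →ₗ[F] F}

/-- Every automorphism of a symplectic group is induced by a semilinear bijection. -/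
theorem exists_semilinear (hS : IsIsometryRep ρ ω) [Finite F] [Finite V] [Finite H]
    [FiniteDimensional F V] [Nontrivial V] (hF : 3 < Nat.card F) (h2 : (2 : F) ≠ 0)
    (σ : MulAut H) :
    ∃ (s : V →+ V) (φ : F →+* F), Function.Injective s ∧ (∀ c v, s (c • v) = φ c • s v) ∧
      ∀ h v, s (ρ h v) = ρ (σ h) (s v) := by
  classical
  obtain ⟨v₀, hv₀⟩ := exists_ne (0 : V)
  obtain ⟨v₁, hv₁, hτ⟩ := hS.exists_map_tau h2 hv₀ σ
  have hτ0 : ∀ {v a w b}, v ≠ 0 → a ≠ 0 → σ (hS.tau v a) = hS.tau w b → b ≠ 0 := by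
    rintro v a w b hv ha h rfl
    have h1 : hS.tau w 0 = 1 := hS.ext fun x => by simp [tau_apply]
    rw [h1] at h
    exact ha (hS.eq_zero_of_tau_eq_one hv (σ.injective (by rw [h, map_one])))
  -- The stabilizer of `v₀` is generated by transvections commuting with those along `v₀`; their
  -- images commute with transvections along `v₁`, hence fix `v₁`. This makes the map `ρ h v₀ ↦ ρ (σ
  -- h) v₁` below well defined.
  have hstab : ∀ h, ρ h v₀ = v₀ → ρ (σ h) v₁ = v₁ := by
    intro h hh
    have hmem := hS.mem_closure_tau hF v₀ h hh
    induction hmem using Subgroup.closure_induction with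
    | mem g hg =>
      obtain ⟨u, a, hu, rfl⟩ := hg
      by_cases hu0 : u = 0
      · rw [show hS.tau u a = 1 from hS.ext fun x => by simp [tau_apply, hu0], map_one, map_one,
          Module.End.one_apply]
      obtain ⟨b, hb⟩ := hτ 1
      have hb0 := hτ0 hv₀ one_ne_zero hb
      obtain ⟨u', hu', hτu⟩ := hS.exists_map_tau h2 hu0 σ
      obtain ⟨a', ha'⟩ := hτu a
      have hc := congrArg σ (hS.tau_comm a 1 (hS.swap_eq_zero hu))
      rw [map_mul, map_mul, ha', hb] at hc
      rw [ha', tau_apply]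
      by_cases ha0 : a' = 0
      · simp [ha0]
      · rw [hS.swap_eq_zero (hS.eq_zero_of_tau_comm ha0 hb0 hu' hc)]
        simp
    | one => simp
    | mul g h hgC hhC ihg ihh =>
      have hfix : ∀ x ∈ Subgroup.closure {g | ∃ u a, ω v₀ u = 0 ∧ g = hS.tau u a},
          ρ x v₀ = v₀ := by
        intro x hx
        induction hx using Subgroup.closure_induction with
        | mem g hg =>
          obtain ⟨u, a, hu, rfl⟩ := hg
          simp [tau_apply, hu]
        | one => simp
        | mul g h _ _ ihg ihh => rw [mul_apply, ihh, ihg]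
        | inv g _ ih =>
          conv_lhs => rw [← ih]
          exact inv_apply_self ρ g v₀
      rw [map_mul, mul_apply, ihh (hfix h hhC), ihg (hfix g hgC)]
    | inv g _ ih =>
      have h3 := ih (by
        conv_lhs => rw [← hh]
        exact apply_inv_self ρ g v₀)
      rw [map_inv]
      conv_lhs => rw [← h3]
      exact inv_apply_self ρ _ v₁
  have htrans : ∀ v, v ≠ 0 → ∃ h, ρ h v₀ = v := fun v hv => hS.exists_apply_eq hF hv₀ hv
  choose k hk using htrans
  let s : V → V := fun v => if hv : v = 0 then 0 else ρ (σ (k v hv)) v₁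
  have hs0 : s 0 = 0 := by simp [s]
  have happ0 : ∀ h v, ρ h v = 0 → v = 0 := fun h v hv => by
    rw [← inv_apply_self ρ h v, hv, map_zero]
  have hs : ∀ h, s (ρ h v₀) = ρ (σ h) v₁ := by
    intro h
    have hne : ρ h v₀ ≠ 0 := fun h0 => hv₀ (happ0 h v₀ h0)
    simp only [s, dif_neg hne]
    have h3 := hstab (h⁻¹ * k _ hne) (by rw [mul_apply, hk, inv_apply_self])
    rw [map_mul, map_inv, mul_apply] at h3
    conv_rhs => rw [← h3]
    rw [apply_inv_self]
  have hequiv : ∀ h v, s (ρ h v) = ρ (σ h) (s v) := by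
    intro h v
    by_cases hv : v = 0
    · rw [hv, map_zero, hs0, map_zero]
    · rw [← hk v hv, ← mul_apply, hs, hs, map_mul, mul_apply]
  have hsnz : ∀ v, v ≠ 0 → s v ≠ 0 := by
    intro v hv h
    rw [← hk v hv, hs] at h
    exact hv₁ (happ0 _ _ h)
  have hstau : ∀ v, v ≠ 0 → ∀ a, ∃ a', σ (hS.tau v a) = hS.tau (s v) a' := by
    intro v hv a
    obtain ⟨a', ha'⟩ := hτ a
    refine ⟨a', ?_⟩
    rw [← hk v hv, ← conj_tau, map_mul, map_mul, ha', map_inv, conj_tau, hs]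
  have hstau' : ∀ v w, w ≠ 0 → ∀ a, ∃ c : F, s (ρ (hS.tau w a) v) = s v + c • s w := by
    intro v w hw a
    obtain ⟨a', ha'⟩ := hstau w hw a
    exact ⟨_, by rw [hequiv, ha', tau_apply]⟩
  have hperp : ∀ v w, ω v w ≠ 0 → ω (s v) (s w) ≠ 0 := by
    intro v w hvw h
    have hv : v ≠ 0 := fun h0 => hvw (by rw [h0, map_zero, LinearMap.zero_apply])
    have hw : w ≠ 0 := fun h0 => hvw (by rw [h0, map_zero])
    obtain ⟨a, ha⟩ := hstau v hv 1
    obtain ⟨b, hb⟩ := hstau w hw 1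
    have hc := hS.tau_comm a b h
    rw [← ha, ← hb, ← map_mul, ← map_mul] at hc
    exact hvw (hS.eq_zero_of_tau_comm one_ne_zero one_ne_zero hv (σ.injective hc))
  -- A transvection along `w` takes `v` to `v + w`, so `s (v + w) - s v` is a multiple of `s w`.
  -- Exchanging the roles and pairing with `s v` shows that the factor is `1`.
  have hadd1 : ∀ v w, ω v w ≠ 0 → s (v + w) = s v + s w := by
    have key : ∀ v w, ω v w ≠ 0 → ∃ c : F, s (v + w) = s v + c • s w := by
      intro v w hvw
      have hw : w ≠ 0 := fun h0 => hvw (by rw [h0, map_zero])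
      obtain ⟨c, hc⟩ := hstau' v w hw (ω v w)⁻¹
      refine ⟨c, ?_⟩
      rw [← hc, tau_apply, inv_mul_cancel₀ hvw, one_smul]
    intro v w hvw
    obtain ⟨c, hc⟩ := key v w hvw
    obtain ⟨d, hd⟩ := key w v (by rwa [hS.neg, neg_ne_zero])
    rw [add_comm w v, hc] at hd
    have h3 := congrArg (ω (s v)) hd
    simp only [map_add, map_smul, hS.alt, smul_eq_mul, mul_zero, zero_add, add_zero] at h3
    have h4 : c = 1 := by
      have : (c - 1) * ω (s v) (s w) = 0 := by linear_combination h3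
      exact sub_eq_zero.1 ((mul_eq_zero.1 this).resolve_right (hperp v w hvw))
    rw [hc, h4, one_smul]
  have hadd : ∀ v w, s (v + w) = s v + s w := by
    intro v w
    by_cases hv : v = 0
    · rw [hv, hs0, zero_add, zero_add]
    by_cases hw : w = 0
    · rw [hw, hs0, add_zero, add_zero]
    by_cases hvw : v + w = 0
    · obtain ⟨u, hu⟩ := hS.exists_eq_one hv
      have hw' : w = -v := eq_neg_of_add_eq_zero_right hvw
      have h3 := hadd1 (u + v) w (by simp [hw', hS.alt, hu])
      rw [add_assoc, hvw, add_zero, hadd1 u v (by simp [hu])] at h3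
      rw [hvw, hs0]
      have : s u + 0 = s u + (s v + s w) := by rw [add_zero, ← add_assoc]; exact h3
      exact add_left_cancel this
    by_cases h0 : ω v w = 0
    -- For orthogonal `v` and `w`, expand `s (u + v + w)` in two ways with `u` orthogonal to none of
    -- `v`, `w`, `v + w`.
    · obtain ⟨u, hu1, hu2, hu3⟩ := exists_three_ne_zero hF (hS.ne_zero hv) (hS.ne_zero hw)
        (hS.ne_zero hvw)
      have hu1' : ω u v ≠ 0 := by rwa [hS.neg, neg_ne_zero]
      have hu2' : ω u w ≠ 0 := by rwa [hS.neg, neg_ne_zero]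
      have hu3' : ω u (v + w) ≠ 0 := by rwa [hS.neg, neg_ne_zero]
      have h3 := hadd1 (u + v) w (by simpa [h0] using hu2')
      rw [add_assoc, hadd1 u _ hu3', hadd1 u v hu1', add_assoc] at h3
      exact add_left_cancel h3
    · exact hadd1 v w h0
  have hline : ∀ c : F, ∃ d : F, s (c • v₀) = d • s v₀ := by
    intro c
    obtain ⟨w, hw⟩ := hS.exists_eq_one hv₀
    obtain ⟨d, hd⟩ := hstau' w v₀ hv₀ c
    rw [tau_apply, hw, mul_one, hadd] at hd
    exact ⟨d, add_left_cancel hd⟩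
  choose φ hφ using hline
  have hφ' : ∀ c v, s (c • v) = φ c • s v := by
    intro c v
    by_cases hv : v = 0
    · rw [hv, smul_zero, hs0, smul_zero]
    · rw [← hk v hv, ← map_smul, hequiv, hφ, map_smul, ← hequiv]
  have hinj := smul_left_injective F (hsnz v₀ hv₀)
  refine ⟨AddMonoidHom.mk' s hadd,
    { toFun := φ
      map_one' := hinj ?_
      map_mul' := fun c d => hinj ?_
      map_zero' := hinj ?_
      map_add' := fun c d => hinj ?_ }, ?_, hφ', hequiv⟩
  · change φ 1 • s v₀ = (1 : F) • s v₀
    rw [← hφ, one_smul, one_smul]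
  · change φ (c * d) • s v₀ = (φ c * φ d) • s v₀
    rw [← hφ, mul_smul, hφ', hφ, mul_smul]
  · change φ 0 • s v₀ = (0 : F) • s v₀
    rw [← hφ, zero_smul, zero_smul, hs0]
  · change φ (c + d) • s v₀ = (φ c + φ d) • s v₀
    rw [← hφ, add_smul, hadd, hφ, hφ, add_smul]
  · rw [injective_iff_map_eq_zero]
    intro v hv
    by_contra hne
    exact hsnz v hne hv

/-- Additive maps commuting with the symplectic group are scalar. -/
theorem exists_eq_smul_of_commute (hS : IsIsometryRep ρ ω) [Finite F] (hF : 3 < Nat.card F)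
    [Nontrivial V] (s : V →+ V) (hs : ∀ h v, s (ρ h v) = ρ h (s v)) : ∃ c : F, ∀ v, s v = c • v := by
  obtain ⟨v₀, hv₀⟩ := exists_ne (0 : V)
  obtain ⟨w, hw⟩ := hS.exists_eq_one hv₀
  have h1 := hs (hS.tau v₀ 1) w
  rw [tau_apply, tau_apply, map_add, hw, mul_one, one_smul, one_mul, add_right_inj] at h1
  refine ⟨ω (s w) v₀, fun v => ?_⟩
  by_cases hv : v = 0
  · rw [hv, map_zero, smul_zero]
  obtain ⟨h, rfl⟩ := hS.exists_apply_eq hF hv₀ hv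
  rw [hs, ← map_smul, ← h1]

/-- A linear map inducing an automorphism of the symplectic group is a similitude. -/
theorem exists_multiplier (hS : IsIsometryRep ρ ω) [Finite F] [Finite V] (hF : 3 < Nat.card F)
    [Nontrivial V] (σ : MulAut H) (s : V →ₗ[F] V) (hinj : Function.Injective s)
    (hs : ∀ h v, s (ρ h v) = ρ (σ h) (s v)) :
    ∃ l : F, l ≠ 0 ∧ ∀ x y, ω (s x) (s y) = l * ω x y := by
  obtain ⟨v₀, hv₀⟩ := exists_ne (0 : V)
  obtain ⟨w, hw⟩ := hS.exists_eq_one hv₀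
  have hsurj := Finite.surjective_of_injective hinj
  -- The image of a transvection along `v₀` is an isometry; testing this on `s w` and `s y` compares
  -- the two forms at `v₀`. Transitivity does the rest.
  have key : ∀ y, ω (s v₀) (s y) = ω (s v₀) (s w) * -ω v₀ y := by
    intro y
    have h1 := hS.isometry (σ (hS.tau v₀ 1)) (s w) (s y)
    rw [← hs, ← hs, tau_apply, tau_apply, hw] at h1
    simp only [map_add, map_smul, LinearMap.add_apply, LinearMap.smul_apply, smul_eq_mul,
      hS.alt] at h1
    rw [hS.neg (s w) (s v₀), hS.neg y v₀] at h1
    linear_combination h1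
  have hall : ∀ x y, ω (s x) (s y) = -ω (s v₀) (s w) * ω x y := by
    intro x y
    by_cases hx : x = 0
    · simp [hx]
    obtain ⟨h, rfl⟩ := hS.exists_apply_eq hF hv₀ hx
    have h2 : ω (s (ρ h v₀)) (s y) = ω (s v₀) (s (ρ h⁻¹ y)) := by
      rw [hs]
      conv_lhs => rw [← apply_inv_self ρ h y, hs]
      exact hS.isometry _ _ _
    have h3 : ω (ρ h v₀) y = ω v₀ (ρ h⁻¹ y) := by
      conv_lhs => rw [← apply_inv_self ρ h y]
      exact hS.isometry _ _ _
    rw [h2, h3, key]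
    ring
  refine ⟨_, fun h0 => ?_, hall⟩
  refine hv₀ (hinj ?_)
  rw [map_zero]
  refine hS.nondeg _ fun y => ?_
  obtain ⟨y, rfl⟩ := hsurj y
  rw [hall, h0, zero_mul]

end IsIsometryRep

/-! ### Field automorphisms and similitudes for `q ≡ 5 (mod 8)`. -/

/-- A finite field whose order is `5` modulo `8` has no involutory automorphism. -/
theorem FiniteField.ringHom_apply_eq_self {F : Type*} [Field F] [Finite F]
    (h4 : 4 ∣ Nat.card F - 1) (h8 : ¬ 8 ∣ Nat.card F - 1) (h2 : (2 : F) ≠ 0) (θ : F →+* F)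
    (hθ : ∀ x, θ (θ x) = x) (x : F) : θ x = x := by
  by_contra hx
  set u := x - θ x with hu
  have hu0 : u ≠ 0 := sub_ne_zero.2 (Ne.symm hx)
  have hθu : θ u = -u := by rw [hu, map_sub, hθ]; ring
  let K := {y : F // θ y = y}
  -- The field is the sum of the two eigenspaces of `θ`, namely `K` and `u * K`. So its order is a
  -- square, which is never `5` modulo `8`.
  let e : K × K ≃ F :=
    { toFun := fun p => p.1.1 + u * p.2.1
      invFun := fun y => (⟨(y + θ y) / 2, by rw [map_div₀, map_add, hθ, map_ofNat, add_comm]⟩,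
        ⟨(y - θ y) / (2 * u), by
          rw [map_div₀, map_sub, map_mul, hθ, hθu, map_ofNat]
          field_simp
          ring⟩)
      left_inv := by
        rintro ⟨⟨a, ha⟩, b, hb⟩
        ext
        · simp only [map_add, map_mul, ha, hb, hθu]
          field_simp
          ring
        · simp only [map_add, map_mul, ha, hb, hθu]
          field_simp
          ring
      right_inv := fun y => by
        simp only
        field_simp
        ring }
  have hcard := Nat.card_congr e
  rw [Nat.card_prod] at hcard
  have hpos : 1 < Nat.card F := Finite.one_lt_card
  rw [← hcard] at h4 h8 hpos
  generalize Nat.card K = m at *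
  have hm : m % 8 < 8 := Nat.mod_lt _ (by norm_num)
  have h1 : m * m % 8 = (m % 8) * (m % 8) % 8 := Nat.mul_mod _ _ _
  interval_cases m % 8 <;> omega

namespace IsIsometryRep

variable {F V H : Type*} [Field F] [AddCommGroup V] [Module F V] [Group H]
  {ρ : Representation F H V} {ω : V →ₗ[F] V →ₗ[F] F}

/-- If `|F| ≡ 5 (mod 8)`, automorphisms of order dividing `4` of the symplectic group over `F` are
induced by similitudes. -/
theorem exists_similitude (hS : IsIsometryRep ρ ω) [Finite F] [Finite V] [Finite H]
    [FiniteDimensional F V] [Nontrivial V] (h4 : 4 ∣ Nat.card F - 1) (h8 : ¬ 8 ∣ Nat.card F - 1)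
    (h2 : (2 : F) ≠ 0) (σ : MulAut H) (hσ : ∀ h, σ (σ (σ (σ h))) = h) :
    ∃ (g : V →ₗ[F] V) (l : F), Function.Injective g ∧ l ≠ 0 ∧
      (∀ h v, g (ρ h v) = ρ (σ h) (g v)) ∧ ∀ x y, ω (g x) (g y) = l * ω x y := by
  have hF : 3 < Nat.card F := by
    have : 1 < Nat.card F := Finite.one_lt_card
    omega
  obtain ⟨s, φ, hinj, hφ, hs⟩ := hS.exists_semilinear hF h2 σ
  obtain ⟨c, hc⟩ := hS.exists_eq_smul_of_commute hF (s.comp (s.comp (s.comp s)))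
    (fun h v => by simp only [AddMonoidHom.comp_apply, hs, hσ])
  simp only [AddMonoidHom.comp_apply] at hc
  have hφ4 : ∀ a, φ (φ (φ (φ a))) = a := by
    intro a
    obtain ⟨v, hv⟩ := exists_ne (0 : V)
    have h1 := hc (a • v)
    simp only [hφ, hc] at h1
    rw [smul_comm c a v] at h1
    refine smul_left_injective F (?_ : c • v ≠ 0) h1
    rw [← hc]
    intro h0
    rw [← map_zero s] at h0
    have := hinj h0
    rw [← map_zero s] at this
    have := hinj this
    rw [← map_zero s] at this
    have := hinj this
    rw [← map_zero s] at this
    exact hv (hinj this)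
  -- The fourth power of `s` is scalar, so `φ` has order dividing `4`. Excluding involutions first
  -- for `φ²` and then for `φ` makes `φ` trivial.
  have hφ2 : ∀ a, φ (φ a) = a := FiniteField.ringHom_apply_eq_self h4 h8 h2 (φ.comp φ) hφ4
  have hφ1 : ∀ a, φ a = a := FiniteField.ringHom_apply_eq_self h4 h8 h2 φ hφ2
  let g : V →ₗ[F] V :=
    { toFun := s
      map_add' := s.map_add
      map_smul' := fun a v => by rw [hφ, hφ1, RingHom.id_apply] }
  obtain ⟨l, hl, hl'⟩ := hS.exists_multiplier hF σ g hinj hs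
  exact ⟨g, l, hinj, hl, hs, hl'⟩

/-- Dividing `g` by a square root of its multiplier gives an isometry inducing the same
automorphism. -/
theorem exists_eq_conj_of_isSquare (hS : IsIsometryRep ρ ω) [Finite V] {σ : MulAut H}
    {g : V →ₗ[F] V} {l : F} (hinj : Function.Injective g) (hl : l ≠ 0)
    (hg : ∀ h v, g (ρ h v) = ρ (σ h) (g v)) (hgω : ∀ x y, ω (g x) (g y) = l * ω x y)
    (hsq : IsSquare l) : ∃ k, ∀ h, σ h = k * h * k⁻¹ := by
  obtain ⟨m, rfl⟩ := hsq
  have hm : m ≠ 0 := fun h => hl (by rw [h, zero_mul])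
  obtain ⟨k, hk⟩ := hS.full (m⁻¹ • g) fun x y => by
    simp only [LinearMap.smul_apply, map_smul, smul_eq_mul, hgω]
    field_simp
  refine ⟨k, fun h => hS.ext fun x => ?_⟩
  obtain ⟨y, rfl⟩ := Finite.surjective_of_injective hinj x
  have h1 : g y = m • ρ k y := by
    rw [hk, LinearMap.smul_apply, smul_smul, mul_inv_cancel₀ hm, one_smul]
  rw [← hg, h1, map_smul, mul_apply, inv_apply_self, mul_apply, hk, LinearMap.smul_apply, smul_smul,
    mul_inv_cancel₀ hm, one_smul]

end IsIsometryRep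

/-! ### The subgroups `Q₈ × C₄` of `Q₈ × Q₈`. -/

section

open BlockTheory

/-- Standard generators of a subgroup `R ≅ Q₈ × C₄`: `i`, `j` generate the quaternion factor and
`c` the cyclic one. -/
structure IsQuaternionCyclic {E : Type*} [Group E] (R : Subgroup E) (i j c : E) : Prop where
  mem_i : i ∈ R
  mem_j : j ∈ R
  mem_c : c ∈ R
  gen : ∀ r ∈ R, ∃ k m n : ℕ, r = c ^ k * i ^ m * j ^ n
  sq_eq : i * i = j * j
  sq_ne : i * i ≠ 1
  sq_sq : i * i * (i * i) = 1
  i_j : i * j = i * i * (j * i)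
  c_i : c * i = i * c
  c_j : c * j = j * c
  c_sq_sq : c * c * (c * c) = 1
  c_sq_ne : c * c ≠ 1
  c_sq_ne' : c * c ≠ i * i
  central_sq : ∀ r ∈ R, r * i = i * r → r * j = j * r → r * r = 1 ∨ r * r = c * c
  central_inv : ∀ r ∈ R, r * i = i * r → r * j = j * r → r * r = 1 →
    r = 1 ∨ r = i * i ∨ r = c * c ∨ r = i * i * (c * c)
  conj_j : ∀ r ∈ R, r * j = j * r ∨ r * j = i * i * (j * r)

theorem isQuaternionCyclic_map_iff {E E' : Type*} [Group E] [Group E'] {f : E →* E'}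
    (hf : Function.Injective f) {R : Subgroup E} {i j c : E} :
    IsQuaternionCyclic (R.map f) (f i) (f j) (f c) ↔ IsQuaternionCyclic R i j c := by
  have hmem : ∀ x, f x ∈ R.map f ↔ x ∈ R := fun x => Subgroup.mem_map_iff_mem hf
  have hall : ∀ p : E' → Prop, (∀ r ∈ R.map f, p r) ↔ ∀ r ∈ R, p (f r) := fun p => by simp
  constructor
  · rintro ⟨h1, h2, h3, h4, h5, h6, h7, h8, h9, h10, h11, h12, h13, h14, h15, h16⟩
    simp only [hall, hmem, ← map_mul, ← map_pow, hf.eq_iff, Ne, map_eq_one_iff f hf] at *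
    exact ⟨h1, h2, h3, h4, h5, h6, h7, h8, h9, h10, h11, h12, h13, h14, h15, h16⟩
  · rintro ⟨h1, h2, h3, h4, h5, h6, h7, h8, h9, h10, h11, h12, h13, h14, h15, h16⟩
    constructor <;>
    · simp only [hall, hmem, ← map_mul, ← map_pow, hf.eq_iff, Ne, map_eq_one_iff f hf]
      assumption

namespace BlockTheory.Q8

open QuaternionGroup

theorem exists_inverting : ∀ x : Q8, x * x ≠ 1 → ∃ y : Q8, y * x = x⁻¹ * y ∧ y * x ≠ x * y := by
  decide

theorem exists_eq_pow : ∀ x y : Q8, x * x ≠ 1 → y * x = x * y → ∃ k : Fin 4, y = x ^ (k : ℕ) := by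
  decide

theorem exists_eq_pow_mul_pow :
    ∀ y : Q8, ∃ (m : Fin 4) (n : Fin 2), y = a 1 ^ (m : ℕ) * xa 0 ^ (n : ℕ) := by
  decide

theorem pow_four : ∀ x : Q8, x * x * (x * x) = 1 := by
  decide

theorem central : ∀ y : Q8, y * a 1 = a 1 * y → y * xa 0 = xa 0 * y →
    y * y = 1 ∧ (y = 1 ∨ y = a 1 * a 1) := by
  decide

theorem sq_of_commute : ∀ x y : Q8, x * x ≠ 1 → y * x = x * y →
    (y * y = 1 ∨ y * y = x * x) ∧ (y * y = 1 → y = 1 ∨ y = x * x) := by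
  decide

theorem mul_xa : ∀ y : Q8, y * xa 0 = xa 0 * y ∨ y * xa 0 = a 1 * a 1 * (xa 0 * y) := by
  decide

/-- A subgroup of `Q₈ × Q₈` of index at most two centralizing an element of order four. -/
theorem exists_generators_aux {R : Subgroup (Q8 × Q8)}
    (hidx : ∀ a b, a ∉ R → b ∉ R → a * b ∈ R) {x y : Q8} (hR : ∀ r ∈ R, r * (x, y) = (x, y) * r)
    (hx : x * x ≠ 1) :
    ∃ i j c d, IsQuaternionCyclic R i j c ∧ d ∉ R ∧ d * i = i * d ∧ d * j = j * d ∧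
      d * c = c⁻¹ * d := by
  obtain ⟨x', hx1, hx2⟩ := exists_inverting x hx
  have hRx : ∀ r ∈ R, r.1 * x = x * r.1 := fun r hr => congrArg Prod.fst (hR r hr)
  have hd : ((x', 1) : Q8 × Q8) ∉ R := fun h => hx2 (hRx _ h)
  -- The element `(x', 1)` is outside `R`, so the index condition puts the whole centralizer of `x`
  -- in the first coordinate into `R`. Thus `R` is `⟨x⟩ × Q₈`, and `x'` supplies `d`.
  have hM : ∀ r : Q8 × Q8, r.1 * x = x * r.1 → r ∈ R := by
    intro r hr
    by_contra hrR
    have h1 := hRx _ (hidx r (x', 1) hrR hd)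
    simp only [Prod.fst_mul] at h1
    refine hx2 (mul_left_cancel (a := r.1) ?_)
    rw [← mul_assoc, h1, ← mul_assoc, ← mul_assoc, hr]
  refine ⟨(1, a 1), (1, xa 0), (x, 1), (x', 1), ?_, hd, ?_, ?_, ?_⟩
  · refine ⟨hM _ (by simp), hM _ (by simp), hM _ (by simp), ?_, ?_, ?_, ?_, ?_, ?_, ?_, ?_, ?_, ?_,
      ?_, ?_, ?_⟩
    · rintro ⟨u, w⟩ hr
      obtain ⟨k, hk⟩ := exists_eq_pow x u hx (hRx _ hr)
      obtain ⟨m, n, hmn⟩ := exists_eq_pow_mul_pow w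
      exact ⟨k, m, n, Prod.ext (by simp [hk]) (by simp [hmn])⟩
    · exact Prod.ext rfl (by decide)
    · exact fun h => absurd (congrArg Prod.snd h) (by decide)
    · exact Prod.ext rfl (by decide)
    · exact Prod.ext rfl (by decide)
    · exact Prod.ext (by simp) (by simp)
    · exact Prod.ext (by simp) (by simp)
    · exact Prod.ext (pow_four x) rfl
    · exact fun h => hx (congrArg Prod.fst h)
    · exact fun h => absurd (congrArg Prod.snd h)
        (show ¬ (1 * 1 : Q8) = a 1 * a 1 by decide)
    · rintro ⟨u, w⟩ hr hi hj
      have h1 := (central w (congrArg Prod.snd hi) (congrArg Prod.snd hj)).1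
      rcases (sq_of_commute x u hx (hRx _ hr)).1 with h | h
      · exact .inl (Prod.ext h h1)
      · exact .inr (Prod.ext h h1)
    · rintro ⟨u, w⟩ hr hi hj hrr
      have h1 := (central w (congrArg Prod.snd hi) (congrArg Prod.snd hj)).2
      rcases (sq_of_commute x u hx (hRx _ hr)).2 (congrArg Prod.fst hrr) with rfl | rfl <;>
        rcases h1 with rfl | rfl <;> simp
    · rintro ⟨u, w⟩ -
      rcases mul_xa w with h | h
      · exact .inl (Prod.ext (by simp) h)
      · exact .inr (Prod.ext (by simp) h)
  · exact Prod.ext (by simp) (by simp)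
  · exact Prod.ext (by simp) (by simp)
  · exact Prod.ext hx1 (by simp)

/-- Some coordinate of `p` has order four; exchange the factors if it is the second. -/
theorem exists_generators {E : Type*} [Group E] (e : E ≃* Q8 × Q8) {R : Subgroup E}
    (hidx : ∀ a b, a ∉ R → b ∉ R → a * b ∈ R) {p : E} (hR : ∀ r ∈ R, r * p = p * r)
    (hp : p * p ≠ 1) :
    ∃ i j c d, IsQuaternionCyclic R i j c ∧ d ∉ R ∧ d * i = i * d ∧ d * j = j * d ∧
      d * c = c⁻¹ * d := by
  have key : ∀ e : E ≃* Q8 × Q8, (e p).1 * (e p).1 ≠ 1 →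
      ∃ i j c d, IsQuaternionCyclic R i j c ∧ d ∉ R ∧ d * i = i * d ∧ d * j = j * d ∧
      d * c = c⁻¹ * d := by
    intro e he
    have hmem : ∀ x, x ∈ R.map e.toMonoidHom ↔ e.symm x ∈ R := fun x => by
      rw [Subgroup.mem_map_equiv]
    obtain ⟨i, j, c, d, h, hd, hdi, hdj, hdc⟩ := exists_generators_aux (R := R.map e.toMonoidHom)
      (x := (e p).1) (y := (e p).2)
      (fun a b ha hb => by
        rw [hmem] at *
        rw [map_mul]
        exact hidx _ _ ha hb)
      (fun r hr => by
        rw [hmem] at hr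
        have := congrArg e (hR _ hr)
        simpa using this) he
    refine ⟨e.symm i, e.symm j, e.symm c, e.symm d, ?_, ?_, ?_, ?_, ?_⟩
    · rw [← isQuaternionCyclic_map_iff (f := e.toMonoidHom) e.injective]
      simpa using h
    · rwa [← hmem]
    · rw [← map_mul, hdi, map_mul]
    · rw [← map_mul, hdj, map_mul]
    · rw [← map_mul, hdc, map_mul, map_inv]
  by_cases h : (e p).1 * (e p).1 = 1
  · refine key (e.trans MulEquiv.prodComm) fun h' => hp (e.injective ?_)
    rw [map_mul, map_one]
    exact Prod.ext h h'
  · exact key e h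

end BlockTheory.Q8

end

/-! ### Isometries built from the enveloping algebra of `R`, and the contradiction. -/

theorem corner_mul_self {A : Type*} [Ring A] {C e : A} (hee : e * e = e) (hec : e * C = C * e)
    (hce : C * C * e = -e) :
    (-(C * e) + (1 - e)) * (C * e + (1 - e)) = 1 ∧
      (C * e + (1 - e)) * (C * e + (1 - e)) = 1 - 2 * e := by
  have h1 : C * e * (C * e) = -e := by
    rw [mul_assoc, ← mul_assoc e, hec, mul_assoc C e e, hee, ← mul_assoc, hce]
  have h2 : C * e * (1 - e) = 0 := by rw [mul_sub, mul_one, mul_assoc, hee, sub_self]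
  have h3 : (1 - e) * (C * e) = 0 := by
    rw [sub_mul, one_mul, ← mul_assoc, hec, mul_assoc, hee, sub_self]
  have h4 : (1 - e) * (1 - e) = 1 - e := by
    rw [sub_mul, one_mul, mul_sub, mul_one, hee, sub_self, sub_zero]
  constructor
  · rw [add_mul, mul_add, mul_add, neg_mul, neg_mul, h1, h2, h3, h4]
    noncomm_ring
  · rw [add_mul, mul_add, mul_add, h1, h2, h3, h4]
    noncomm_ring

namespace IsIsometryRep

variable {F V H : Type*} [Field F] [AddCommGroup V] [Module F V] [Group H]
  {ρ : Representation F H V} {ω : V →ₗ[F] V →ₗ[F] F}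

/-- `f'` is the adjoint of `f` with respect to `ω`. -/
def IsAdj (ω : V →ₗ[F] V →ₗ[F] F) (f f' : Module.End F V) : Prop :=
  ∀ x y, ω (f x) y = ω x (f' y)

theorem IsAdj.add {f f' g g' : Module.End F V} (hf : IsAdj ω f f') (hg : IsAdj ω g g') :
    IsAdj ω (f + g) (f' + g') := fun x y => by simp [hf x y, hg x y]

theorem IsAdj.sub {f f' g g' : Module.End F V} (hf : IsAdj ω f f') (hg : IsAdj ω g g') :
    IsAdj ω (f - g) (f' - g') := fun x y => by simp [hf x y, hg x y]

theorem IsAdj.mul {f f' g g' : Module.End F V} (hf : IsAdj ω f f') (hg : IsAdj ω g g') :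
    IsAdj ω (f * g) (g' * f') := fun x y => by simp [hf _ y, hg x _]

theorem IsAdj.smul {f f' : Module.End F V} (a : F) (hf : IsAdj ω f f') :
    IsAdj ω (a • f) (a • f') := fun x y => by simp [hf x y]

theorem IsAdj.one : IsAdj ω 1 1 := fun _ _ => rfl

theorem isAdj_rho (hS : IsIsometryRep ρ ω) (h : H) : IsAdj ω (ρ h) (ρ h⁻¹) := fun x y => by
  rw [← hS.isometry h x, apply_inv_self]

theorem exists_rho_eq (hS : IsIsometryRep ρ ω) {f f' : Module.End F V} (hf : IsAdj ω f f')
    (h : f' * f = 1) : ∃ k, ρ k = f :=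
  hS.full f fun x y => by
    rw [hf, ← Module.End.mul_apply, h, Module.End.one_apply]

theorem eq_of_pow_mem {R : Subgroup H} {h : H} (h4 : h ^ 4 = 1) {m : ℕ} (hm : Odd m)
    (hR : h ^ m ∈ R) : h ∈ R := by
  have h1 : h = (h ^ m) ^ m := by
    obtain ⟨k, rfl⟩ := hm
    rw [← pow_mul, show (2 * k + 1) * (2 * k + 1) = 4 * (k * k + k) + 1 by ring, pow_succ, pow_mul,
      h4, one_pow, one_mul]
  rw [h1]
  exact R.pow_mem hR m

section Radical

variable {R : Subgroup H} {i j c x₀ : H}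

theorem IsQuaternionCyclic.mul_comm_of_generators (hQ : IsQuaternionCyclic R i j c) {h : H}
    (hi : h * i = i * h) (hj : h * j = j * h) (hc : h * c = c * h) (r : H) (hr : r ∈ R) :
    h * r = r * h := by
  obtain ⟨k, m, n, rfl⟩ := hQ.gen r hr
  exact ((Commute.pow_right hc k).mul_right (Commute.pow_right hi m)).mul_right
    (Commute.pow_right hj n)

/-- The central `2`-elements of the enveloping algebra of `R` which are isometries lie in `R`. -/
theorem mem_of_rho_commute (hS : IsIsometryRep ρ ω) (hQ : IsQuaternionCyclic R i j c)
    (hrad : ∀ y, (∀ r ∈ R, y * r * y⁻¹ ∈ R) → y * x₀ = x₀ * y → ∃ m, Odd m ∧ y ^ m ∈ R)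
    {u : H} (hi : ρ u * ρ i = ρ i * ρ u) (hj : ρ u * ρ j = ρ j * ρ u)
    (hc : ρ u * ρ c = ρ c * ρ u) (hx : ρ u * ρ x₀ = ρ x₀ * ρ u)
    (h4 : ρ u * ρ u * (ρ u * ρ u) = 1) : u ∈ R ∧ u * i = i * u ∧ u * j = j * u := by
  simp only [← map_mul, hS.injective.eq_iff] at hi hj hc hx
  obtain ⟨m, hm, hmR⟩ := hrad u (fun r hr => by
    rwa [IsQuaternionCyclic.mul_comm_of_generators hQ hi hj hc r hr, mul_inv_cancel_right]) hx
  refine ⟨eq_of_pow_mem (hS.injective ?_) hm hmR, hi, hj⟩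
  rw [map_pow, map_one, ← h4]
  simp only [pow_succ, pow_zero, one_mul, mul_assoc]

/-- If `c² = -1` on the image of the central projection `e`, then `e = 0` or `c² = 1 - 2 e`. -/
theorem eq_zero_or_sq_eq (hS : IsIsometryRep ρ ω) (hQ : IsQuaternionCyclic R i j c)
    (h2 : (2 : F) ≠ 0)
    (hrad : ∀ y, (∀ r ∈ R, y * r * y⁻¹ ∈ R) → y * x₀ = x₀ * y → ∃ m, Odd m ∧ y ^ m ∈ R)
    (hx : c * x₀ = x₀ * c) {e : Module.End F V} (he : IsAdj ω e e) (hee : e * e = e)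
    (hei : e * ρ i = ρ i * e) (hej : e * ρ j = ρ j * e) (hec : e * ρ c = ρ c * e)
    (hex : e * ρ x₀ = ρ x₀ * e) (hce : ρ c * ρ c * e = -e) :
    e = 0 ∨ ρ c * ρ c = 1 - 2 * e := by
  have hci : ρ c * ρ i = ρ i * ρ c := by rw [← map_mul, hQ.c_i, map_mul]
  have hcj : ρ c * ρ j = ρ j * ρ c := by rw [← map_mul, hQ.c_j, map_mul]
  have hcx : ρ c * ρ x₀ = ρ x₀ * ρ c := by rw [← map_mul, hx, map_mul]
  have hinv : e * ρ c⁻¹ = -(ρ c * e) := by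
    have h1 : c⁻¹ = c * (c * c) := inv_eq_of_mul_eq_one_right (by rw [← mul_assoc, hQ.c_sq_sq])
    have h3 : e * (ρ c * (ρ c * ρ c)) = ρ c * (ρ c * ρ c * e) := by
      rw [← mul_assoc, hec, mul_assoc, ← mul_assoc e, hec, mul_assoc, hec]
      simp only [mul_assoc]
    rw [h1, map_mul, map_mul, h3, hce, mul_neg]
  have hu := (((isAdj_rho hS c).mul he).add (IsAdj.one.sub he))
  rw [hinv] at hu
  -- The operator equal to `c` on the image of `e` and to `1` on its complement is an isometry `u`
  -- commuting with `R` and `x₀`. So it is a central element of `R`, and its square `1 - 2 * e` can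
  -- only be `1` or `c²`.
  obtain ⟨h1, husq⟩ := corner_mul_self hee hec hce
  obtain ⟨u, huρ⟩ := hS.exists_rho_eq hu h1
  rw [← huρ] at husq
  have hcomm : ∀ b, e * b = b * e → ρ c * b = b * ρ c → ρ u * b = b * ρ u := by
    intro b hb hcb
    rw [huρ, add_mul, mul_add, sub_mul, mul_sub, one_mul, mul_one, mul_assoc, hb, ← mul_assoc, hcb,
      mul_assoc]
  obtain ⟨huR, hui, huj⟩ := hS.mem_of_rho_commute hQ hrad (hcomm _ hei hci) (hcomm _ hej hcj)
    (hcomm _ hec rfl) (hcomm _ hex hcx) (by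
      rw [husq]
      have : (1 - 2 * e) * (1 - 2 * e) = 1 - 4 * (e - e * e) := by noncomm_ring
      rw [this, hee, sub_self, mul_zero, sub_zero])
  rcases hQ.central_sq u huR hui huj with h | h
  · left
    rw [← map_mul, h, map_one] at husq
    have h3 : (2 : F) • e = 0 := by
      have : 2 * e = 0 := by
        rw [eq_sub_iff_add_eq, add_eq_left] at husq
        exact husq
      rw [← this, two_smul, two_mul]
    exact (smul_eq_zero.1 h3).resolve_left h2
  · right
    rw [← map_mul, ← h, map_mul, husq]

end Radical

end IsIsometryRep

/-- On the image of `E` the element `I - E + C * E` acts as `C`, on the complement as `I`, and both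
have square `-1` there. -/
theorem rotation_mul_self {A : Type*} [Ring A] {C E I : A} (hEE : E * E = E) (hEC : E * C = C * E)
    (hEI : E * I = E) (hIE : I * E = E) (hIC : I * C = C * I) (hII : I * I = 2 * E - 1)
    (hCE : C * C * E = -E) : (I - E + C * E) * (I - E + C * E) = -1 := by
  have h1 : C * E * (C * E) = -E := by
    rw [mul_assoc, ← mul_assoc E, hEC, mul_assoc C E E, hEE, ← mul_assoc, hCE]
  have h2 : I * (C * E) = C * E := by rw [← mul_assoc, hIC, mul_assoc, hIE]
  have h3 : E * (C * E) = C * E := by rw [← mul_assoc, hEC, mul_assoc, hEE]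
  have h4 : C * E * I = C * E := by rw [mul_assoc, hEI]
  have h5 : C * E * E = C * E := by rw [mul_assoc, hEE]
  rw [add_mul, sub_mul, mul_add, mul_add, mul_add, mul_sub, mul_sub, mul_sub, h1, h2, h3, h4, h5,
    hEE, hEI, hIE, hII]
  noncomm_ring

/-- On the image of `E`, `I` is trivial and `C` commutes with `J`. On the complement `I * J * I =
J`, so multiplying `1 + I` by `J` on the right, or by `I * J` on the left, gives `J + I * J`. -/
theorem rotation_mul {A : Type*} [Ring A] {C E I J : A} (hEC : E * C = C * E)
    (hIE : I * E = E) (hEJ : E * J = J * E) (hEE : E * E = E)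
    (hCJ : C * J = J * C) (hII : I * I = 2 * E - 1) (hIJ : I * J = I * I * (J * I)) :
    (1 + (I - E + C * E)) * J = I * J * (1 + (I - E + C * E)) := by
  have h1 : I * J * E = J * E := by rw [mul_assoc, ← hEJ, ← mul_assoc, hIE]
  have h2 : I * J * I = J := by
    have h3 : (2 * E - 1) * (2 * E - 1) = (1 : A) := by
      have : (2 * E - 1) * (2 * E - 1) = 4 * (E * E - E) + 1 := by noncomm_ring
      rw [this, hEE, sub_self, mul_zero, zero_add]
    have h4 : J * (2 * E - 1) = (2 * E - 1) * J := by
      rw [mul_sub, sub_mul, mul_one, one_mul, mul_assoc, hEJ, two_mul, two_mul, mul_add]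
    rw [hIJ, mul_assoc (I * I), mul_assoc J, hII, h4, ← mul_assoc, h3, one_mul]
  have h5 : I * J * (C * E) = C * E * J := by
    rw [← hEC, ← mul_assoc, h1, mul_assoc, hEC, ← mul_assoc, ← hCJ, mul_assoc, mul_assoc, hEJ]
  rw [add_mul, add_mul, sub_mul, one_mul, mul_add, mul_add, mul_sub, mul_one, h1, h2, h5, hEJ]
  abel

namespace IsIsometryRep

variable {F V H : Type*} [Field F] [AddCommGroup V] [Module F V] [Group H]
  {ρ : Representation F H V} {ω : V →ₗ[F] V →ₗ[F] F} {R : Subgroup H} {i j c x₀ : H}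

theorem involution_projection (hS : IsIsometryRep ρ ω) (h2 : (2 : F) ≠ 0) {z : H}
    (hz : z * z = 1) {E : Module.End F V} (hE : E = (2⁻¹ : F) • (1 + ρ z)) :
    E * E = E ∧ IsAdj ω E E ∧ (∀ b, ρ z * b = b * ρ z → E * b = b * E) ∧ ρ z = 2 * E - 1 := by
  have h1 : ρ z = 2 * E - 1 := by
    rw [hE, eq_sub_iff_add_eq, two_mul, ← two_smul F, smul_smul, mul_inv_cancel₀ h2, one_smul,
      add_comm]
  have h3 : (1 + ρ z) * (1 + ρ z) = (2 : F) • (1 + ρ z) := by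
    rw [two_smul, mul_add, mul_one, add_mul, one_mul, ← map_mul, hz, map_one, add_comm (ρ z) 1]
  refine ⟨?_, ?_, ?_, h1⟩
  · rw [hE, smul_mul_smul_comm, h3, smul_smul, mul_assoc, inv_mul_cancel₀ h2, mul_one]
  · rw [hE]
    refine (IsAdj.one.add ?_).smul _
    have := isAdj_rho hS z
    rwa [inv_eq_of_mul_eq_one_right hz] at this
  · intro b hb
    rw [hE, smul_mul_assoc, mul_smul_comm, add_mul, mul_add, hb, one_mul, mul_one]

/-- The similitude `g` twisted by the enveloping algebra of `R` gives an isometry normalizing `R`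
which induces an outer `2`-automorphism. -/
theorem false_of_similitude_of_projection (hS : IsIsometryRep ρ ω) (hQ : IsQuaternionCyclic R i j c)
    (h2 : (2 : F) ≠ 0)
    (hrad : ∀ y, (∀ r ∈ R, y * r * y⁻¹ ∈ R) → y * x₀ = x₀ * y → ∃ m, Odd m ∧ y ^ m ∈ R)
    (hcx : c * x₀ = x₀ * c) {E : Module.End F V} (hE : E = (2⁻¹ : F) • (1 + ρ (i * i)))
    (hCE : ρ c * ρ c * E = -E) {k : H} (hkR : k ∈ R) (hkk : k * k = i * i)
    (hkj : k * j = i * i * (j * k)) (hck : c * k = k * c) (hkx : k * x₀ = x₀ * k)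
    (hki : ∀ h, h * k = k * h → h * c = c⁻¹ * h → h * i = i * h) (hEk : E * ρ k = E)
    {g : Module.End F V} {l : F} (hgω : ∀ x y, ω (g x) (g y) = l * ω x y)
    (hl : l ≠ 0) (hsq : IsSquare (2 * l)) (hgk : g * ρ k = ρ k * g) (hgj : g * ρ j = ρ j * g)
    (hgc : g * ρ c = ρ c⁻¹ * g) (hgx : g * ρ x₀ = ρ x₀ * g) (hix : i * x₀ = x₀ * i) : False := by
  obtain ⟨hEE, hEadj, hEcomm, hZE⟩ := hS.involution_projection h2 hQ.sq_sq hE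
  have hρ : ∀ {a b : H}, a * b = b * a → ρ a * ρ b = ρ b * ρ a := fun h => by
    rw [← map_mul, h, map_mul]
  have hEρ : ∀ b : H, i * i * b = b * (i * i) → E * ρ b = ρ b * E := fun b hb =>
    hEcomm _ (hρ hb)
  have hcz : i * i * c = c * (i * i) := by
    rw [mul_assoc, ← hQ.c_i, ← mul_assoc, ← hQ.c_i, mul_assoc]
  have hkz : i * i * k = k * (i * i) := by rw [← hkk, mul_assoc]
  have hjz : i * i * j = j * (i * i) := by rw [hQ.sq_eq, mul_assoc]
  have hxz : i * i * x₀ = x₀ * (i * i) := by rw [mul_assoc, hix, ← mul_assoc, hix, mul_assoc]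
  have hEC := hEρ c hcz
  have hkE : ρ k * E = E := by rw [← hEρ k hkz, hEk]
  have hII : ρ k * ρ k = 2 * E - 1 := by rw [← map_mul, hkk, hZE]
  have hIJ : ρ k * ρ j = ρ k * ρ k * (ρ j * ρ k) := by rw [← map_mul, hkj, ← hkk]; simp
  set s := ρ k - E + ρ c * E with hs
  have hss : s * s = -1 := rotation_mul_self hEE hEC hEk hkE (hρ hck).symm hII hCE
  have htj : (1 + s) * ρ j = ρ k * ρ j * (1 + s) :=
    rotation_mul hEC hkE (hEρ j hjz) hEE (hρ hQ.c_j) hII hIJ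
  have hcinv : c⁻¹ = c * (c * c) := inv_eq_of_mul_eq_one_right (by rw [← mul_assoc, hQ.c_sq_sq])
  have hECinv : E * ρ c⁻¹ = -(ρ c * E) := by
    have h3 : E * (ρ c * (ρ c * ρ c)) = ρ c * (ρ c * ρ c * E) := by
      rw [← mul_assoc, hEC, mul_assoc, ← mul_assoc E, hEC, mul_assoc, hEC]
      simp only [mul_assoc]
    rw [hcinv, map_mul, map_mul, h3, hCE, mul_neg]
  have hkinv : ρ k⁻¹ = 2 * E - ρ k := by
    have h1 : k⁻¹ = i * i * k :=
      inv_eq_of_mul_eq_one_right (by rw [hkz, ← mul_assoc, hkk, hQ.sq_sq])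
    rw [h1, map_mul, hZE, sub_mul, one_mul, mul_assoc, hEk]
  have hsadj : IsAdj ω s (-s) := by
    have h1 := ((isAdj_rho hS k).sub hEadj).add ((isAdj_rho hS c).mul hEadj)
    have h3 : -s = ρ k⁻¹ - E + E * ρ c⁻¹ := by
      rw [hkinv, hECinv, hs]
      noncomm_ring
    rwa [h3]
  -- As `s` has adjoint `-s` and square `-1`, the product `(1 - s) * (1 + s)` is `2`.
  have htadj : ∀ x y, ω ((1 + s) x) ((1 + s) y) = 2 * ω x y := by
    intro x y
    have h1 := (IsAdj.one (ω := ω)).add hsadj x ((1 + s) y)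
    rw [h1, ← Module.End.mul_apply]
    have h3 : (1 + -s) * (1 + s) = (2 : F) • (1 : Module.End F V) := by
      have : (1 + -s) * (1 + s) = 1 - s * s := by noncomm_ring
      rw [this, hss, two_smul, sub_neg_eq_add]
    rw [h3]
    simp
  obtain ⟨ν, hν⟩ := hsq
  have hν0 : ν ≠ 0 := fun h => by
    rw [h, zero_mul] at hν
    exact (mul_ne_zero h2 hl) hν
  -- The composite of similitudes of multipliers `2` and `l`, divided by a square root of `2 * l`.
  -- It centralizes `k`, `i` and `x₀`, inverts `c` and takes `j` to `k * j`.
  obtain ⟨h, hh⟩ := hS.full (ν⁻¹ • ((1 + s) * g)) fun x y => by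
    simp only [LinearMap.smul_apply, Module.End.mul_apply, map_smul, smul_eq_mul, htadj, hgω]
    field_simp
    linear_combination (ω x y) * hν
  have hmk : ∀ {a b : H}, (1 + s) * g * ρ a = ρ b * ((1 + s) * g) → h * a = b * h := by
    intro a b hab
    refine hS.injective ?_
    rw [map_mul, map_mul, hh, smul_mul_assoc, mul_smul_comm, hab]
  have hsb : ∀ b, E * b = b * E → ρ k * b = b * ρ k → ρ c * b = b * ρ c →
      (1 + s) * b = b * (1 + s) := by
    intro b h1 h3 h4
    have h5 : ρ c * E * b = b * (ρ c * E) := by rw [mul_assoc, h1, ← mul_assoc, h4, mul_assoc]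
    rw [hs, add_mul, add_mul, sub_mul, h5, h1, h3, one_mul, mul_add, mul_add, mul_sub, mul_one]
  have hhk : h * k = k * h := hmk (by
    rw [mul_assoc, hgk, ← mul_assoc, hsb _ (hEρ k hkz) rfl (hρ hck), mul_assoc])
  have hhc : h * c = c⁻¹ * h := hmk (by
    have h1 : c * c⁻¹ = c⁻¹ * c := by simp
    have h3 : k * c⁻¹ = c⁻¹ * k := ((show Commute c k from hck).inv_left.eq).symm
    have h4 : i * i * c⁻¹ = c⁻¹ * (i * i) := ((show Commute (i * i) c from hcz).inv_right.eq)
    rw [mul_assoc, hgc, ← mul_assoc, hsb _ (hEρ _ h4) (hρ h3) (hρ h1), mul_assoc])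
  have hhj : h * j = k * j * h := hmk (by
    rw [mul_assoc, hgj, ← mul_assoc, htj, map_mul, mul_assoc])
  have hhx : h * x₀ = x₀ * h := hmk (by
    rw [mul_assoc, hgx, ← mul_assoc, hsb _ (hEρ _ hxz) (hρ hkx) (hρ hcx), mul_assoc])
  have hhi := hki h hhk hhc
  obtain ⟨m, ⟨n, rfl⟩, hm⟩ := hrad h (fun r hr => by
    obtain ⟨a, b, d, rfl⟩ := hQ.gen r hr
    have hc1 : SemiconjBy h c c⁻¹ := hhc
    have hi1 : SemiconjBy h i i := hhi
    have hj1 : SemiconjBy h j (k * j) := hhj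
    have := ((hc1.pow_right a).mul_right (hi1.pow_right b)).mul_right (hj1.pow_right d)
    rw [this.eq, mul_inv_cancel_right]
    exact R.mul_mem (R.mul_mem (R.pow_mem (R.inv_mem hQ.mem_c) _) (R.pow_mem hQ.mem_i _))
      (R.pow_mem (R.mul_mem hkR hQ.mem_j) _)) hhx
  set z := i * i with hz
  have hhz : h * z = z * h := by rw [hz, ← mul_assoc, hhi, mul_assoc, hhi, mul_assoc]
  have h2j : h * h * j = z * j * (h * h) := by
    rw [mul_assoc, hhj, ← mul_assoc, ← mul_assoc, hhk, mul_assoc k, hhj, ← hkk]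
    simp only [mul_assoc]
  -- Two applications of `h` multiply `j` by `k² = z`. So even powers of `h` multiply it by `1` or
  -- `z`, and odd powers by `k` or `z * k`.
  have hpow : ∀ n : ℕ, ∃ w, (w = 1 ∨ w = z) ∧ (h * h) ^ n * j = w * j * (h * h) ^ n := by
    intro n
    induction n with
    | zero => exact ⟨1, .inl rfl, by simp⟩
    | succ n ih =>
      obtain ⟨w, hw, hwj⟩ := ih
      have hcz' : (h * h) ^ n * z = z * (h * h) ^ n :=
        (((show Commute h z from hhz).mul_left hhz).pow_left n).eq
      refine ⟨z * w, ?_, ?_⟩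
      · rcases hw with rfl | rfl
        · exact .inr (mul_one z)
        · exact .inl hQ.sq_sq
      · rw [pow_succ, mul_assoc, h2j, mul_assoc z, ← mul_assoc, hcz', mul_assoc z,
          ← mul_assoc (_ ^ n) j, hwj]
        simp only [mul_assoc]
  obtain ⟨w, hw, hwj⟩ := hpow n
  have hfin : h ^ (2 * n + 1) * j = w * k * j * h ^ (2 * n + 1) := by
    have h1 : h ^ (2 * n + 1) = h * (h * h) ^ n := by rw [pow_succ', pow_mul, sq]
    have h3 : h * w = w * h := by
      rcases hw with rfl | rfl
      · simp
      · exact hhz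
    rw [h1, mul_assoc, hwj, ← mul_assoc, ← mul_assoc, h3, mul_assoc w, hhj]
    simp only [mul_assoc]
  have hwz : w * w = 1 := by
    rcases hw with rfl | rfl
    · simp
    · exact hQ.sq_sq
  have hwk : w * k = k * w := by
    rcases hw with rfl | rfl
    · simp
    · exact hkz
  -- Elements of `R` multiply `j` only by `1` or `z`, whose squares are `1`, whereas `w * k` has
  -- square `z ≠ 1`.
  have hz1 : ∀ a, (a = 1 ∨ a = z) → w * k = a → False := by
    intro a ha hwa
    have h1 : w * k * (w * k) = z := by
      rw [mul_assoc, ← mul_assoc k, ← hwk, mul_assoc, ← mul_assoc w w, hwz, one_mul, hkk]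
    rw [hwa] at h1
    refine hQ.sq_ne ?_
    rw [← hz, ← h1]
    rcases ha with rfl | rfl
    · simp
    · exact hQ.sq_sq
  rcases hQ.conj_j _ hm with h1 | h1
  · rw [hfin] at h1
    refine hz1 1 (.inl rfl) ?_
    have h3 := mul_right_cancel (h1.trans (by rw [one_mul] : _ = 1 * j * h ^ (2 * n + 1)))
    exact mul_right_cancel h3
  · rw [hfin, ← mul_assoc] at h1
    exact hz1 z (.inr rfl) (mul_right_cancel (mul_right_cancel h1))

/-- It remains to show that `c² = -1` on the fixed space of `i²` and to find a `k` trivial there.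
Both follow from the maximality of `R`, which leaves no room for central isometries other than those
of `R`. -/
theorem false_of_similitude (hS : IsIsometryRep ρ ω) [Nontrivial V]
    (hQ : IsQuaternionCyclic R i j c) (h2 : (2 : F) ≠ 0)
    (hrad : ∀ y, (∀ r ∈ R, y * r * y⁻¹ ∈ R) → y * x₀ = x₀ * y → ∃ m, Odd m ∧ y ^ m ∈ R)
    (hix : i * x₀ = x₀ * i) (hcx : c * x₀ = x₀ * c)
    {g : Module.End F V} {l : F} (hgω : ∀ x y, ω (g x) (g y) = l * ω x y)
    (hl : l ≠ 0) (hsq : IsSquare (2 * l)) (hgi : g * ρ i = ρ i * g) (hgj : g * ρ j = ρ j * g)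
    (hgc : g * ρ c = ρ c⁻¹ * g) (hgx : g * ρ x₀ = ρ x₀ * g) : False := by
  obtain ⟨E, hE⟩ : ∃ E, E = (2⁻¹ : F) • (1 + ρ (i * i)) := ⟨_, rfl⟩
  obtain ⟨hEE, hEadj, hEcomm, hZE⟩ := hS.involution_projection h2 hQ.sq_sq hE
  have hρ : ∀ {a b : H}, a * b = b * a → ρ a * ρ b = ρ b * ρ a := fun h => by
    rw [← map_mul, h, map_mul]
  have hEρ : ∀ b : H, i * i * b = b * (i * i) → E * ρ b = ρ b * E := fun b hb =>
    hEcomm _ (hρ hb)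
  have hcz : i * i * c = c * (i * i) := by
    rw [mul_assoc, ← hQ.c_i, ← mul_assoc, ← hQ.c_i, mul_assoc]
  have hiz : i * i * i = i * (i * i) := mul_assoc _ _ _
  have hjz : i * i * j = j * (i * i) := by rw [hQ.sq_eq, mul_assoc]
  have hxz : i * i * x₀ = x₀ * (i * i) := by rw [mul_assoc, hix, ← mul_assoc, hix, mul_assoc]
  have hEC := hEρ c hcz
  have hEI := hEρ i hiz
  have hEJ := hEρ j hjz
  have hEX := hEρ x₀ hxz
  have hZ1 : E ≠ 1 := fun h => by
    rw [h] at hZE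
    refine hQ.sq_ne (hS.injective ?_)
    rw [hZE, map_one]
    noncomm_ring
  have hZE' : ρ (i * i) * E = E := by
    rw [hZE, sub_mul, mul_assoc, hEE, one_mul, two_mul, add_sub_cancel_right]
  -- The isometry `-1` is central of order `2`, so it is one of the central involutions of `R`. If
  -- it is `i²`, then `E = 0`; if it is `c²`, the complement of `E` gives a contradiction; if it is
  -- `i² * c²`, the claim is immediate.
  have hCE : ρ c * ρ c * E = -E := by
    obtain ⟨y, hy⟩ := hS.full (-1) fun x y => by simp
    obtain ⟨hyR, hyi, hyj⟩ := hS.mem_of_rho_commute hQ hrad (u := y) (by simp [hy]) (by simp [hy])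
      (by simp [hy]) (by simp [hy]) (by simp [hy])
    have hyy : y * y = 1 := hS.injective (by simp [hy])
    rcases hQ.central_inv y hyR hyi hyj hyy with rfl | rfl | rfl | rfl
    · rw [map_one] at hy
      obtain ⟨v, hv⟩ := exists_ne (0 : V)
      have h1 := LinearMap.congr_fun hy v
      rw [Module.End.one_apply, LinearMap.neg_apply, Module.End.one_apply, eq_neg_iff_add_eq_zero,
        ← two_smul F, smul_eq_zero] at h1
      exact absurd h1 (by simp [h2, hv])
    · rw [hE, hy]
      simp
    · rw [map_mul] at hy
      rcases hS.eq_zero_or_sq_eq hQ h2 hrad hcx (e := 1 - E) (IsAdj.one.sub hEadj)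
        (by rw [mul_sub, mul_one, sub_mul, one_mul, hEE, sub_self, sub_zero])
        (by rw [sub_mul, mul_sub, hEI, one_mul, mul_one])
        (by rw [sub_mul, mul_sub, hEJ, one_mul, mul_one])
        (by rw [sub_mul, mul_sub, hEC, one_mul, mul_one])
        (by rw [sub_mul, mul_sub, hEX, one_mul, mul_one])
        (by rw [hy, neg_one_mul]) with h | h
      · exact absurd (sub_eq_zero.1 h).symm hZ1
      · refine absurd (hS.injective ?_) hQ.c_sq_ne'
        rw [map_mul, h, hZE]
        noncomm_ring
    · rw [map_mul, map_mul ρ c c] at hy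
      have h1 : ρ (i * i) * (ρ (i * i) * (ρ c * ρ c)) = -ρ (i * i) := by rw [hy, mul_neg_one]
      rw [← mul_assoc, ← map_mul, hQ.sq_sq, map_one, one_mul] at h1
      rw [h1, neg_mul, hZE']
  -- On the image of `E`, `i` is an involution; `e` projects onto its fixed space there. Maximality
  -- forces `i` to be `1` or `-1` on the whole image, and in the second case `k = i * c²` acts as
  -- `1`.
  obtain ⟨e, he⟩ : ∃ e, e = (2⁻¹ : F) • (E + E * ρ i) := ⟨_, rfl⟩
  have hEII : E * ρ i * ρ i = E := by
    rw [mul_assoc, ← map_mul, hEρ _ rfl, hZE']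
  have hPP : (E + E * ρ i) * (E + E * ρ i) = (2 : F) • (E + E * ρ i) := by
    have h1 : E * (E * ρ i) = E * ρ i := by rw [← mul_assoc, hEE]
    have h3 : E * ρ i * E = E * ρ i := by rw [mul_assoc, ← hEI, h1]
    have h4 : E * ρ i * (E * ρ i) = E := by rw [← mul_assoc, h3, hEII]
    rw [add_mul, mul_add, mul_add, hEE, h1, h3, h4, two_smul]
    abel
  have hee : e * e = e := by
    rw [he, smul_mul_smul_comm, hPP, smul_smul, mul_assoc, inv_mul_cancel₀ h2, mul_one]
  have heb : ∀ b, E * b = b * E → E * ρ i * b = b * (E * ρ i) → e * b = b * e := by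
    intro b h1 h3
    rw [he, smul_mul_assoc, mul_smul_comm, add_mul, mul_add, h1, h3]
  have heE : e * E = e := by
    rw [he, smul_mul_assoc, add_mul, hEE, mul_assoc, ← hEI, ← mul_assoc, hEE]
  have hEadj' : IsAdj ω e e := by
    have h1 : i⁻¹ = i * i * i :=
      inv_eq_of_mul_eq_one_right (by rw [hiz, ← mul_assoc, hQ.sq_sq])
    have h3 := (hEadj.add (hEadj.mul (isAdj_rho hS i))).smul (2⁻¹ : F)
    have h4 : ρ i⁻¹ * E = E * ρ i := by
      rw [h1, hiz, map_mul, mul_assoc, hZE', hEI]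
    rwa [h4, ← he] at h3
  have hEIb : ∀ b, E * b = b * E → ρ i * b = b * ρ i → E * ρ i * b = b * (E * ρ i) := by
    intro b h1 h3
    rw [mul_assoc, h3, ← mul_assoc, h1, mul_assoc]
  have hk : E * ρ i = E ∨ E * ρ i = -E := by
    rcases hS.eq_zero_or_sq_eq hQ h2 hrad hcx (e := e) hEadj' hee
      (heb _ hEI (hEIb _ hEI rfl))
      (heb _ hEJ (by
        have h1 : ρ i * ρ j = ρ (i * i) * (ρ j * ρ i) := by
          rw [← map_mul, hQ.i_j, map_mul ρ (i * i), map_mul ρ j]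
        rw [mul_assoc, h1, ← mul_assoc, hEρ _ rfl, hZE', ← mul_assoc, hEJ, mul_assoc]))
      (heb _ hEC (hEIb _ hEC (hρ hQ.c_i).symm)) (heb _ hEX (hEIb _ hEX (hρ hix)))
      (by rw [he, mul_smul_comm, mul_add, ← mul_assoc, hCE, ← smul_neg, neg_add, neg_mul]) with h | h
    · right
      rw [he, smul_eq_zero] at h
      exact (neg_eq_of_add_eq_zero_right (h.resolve_left (inv_ne_zero h2))).symm
    · left
      rw [h, sub_mul, one_mul, mul_assoc, heE, he, two_mul, ← two_smul F, smul_smul,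
        mul_inv_cancel₀ h2, one_smul] at hCE
      have h5 : E - (E + E * ρ i) = -(E * ρ i) := by abel
      rw [h5] at hCE
      exact neg_injective hCE
  rcases hk with hk | hk
  · exact hS.false_of_similitude_of_projection hQ h2 hrad hcx hE hCE hQ.mem_i rfl hQ.i_j hQ.c_i hix
      (fun h h1 _ => h1) hk hgω hl hsq hgi hgj hgc hgx hix
  · have hcc : i * (c * c) = c * c * i := by
      rw [mul_assoc, hQ.c_i, ← mul_assoc, ← mul_assoc, hQ.c_i]
    have hinv : c⁻¹ * c⁻¹ = c * c := by
      rw [← mul_inv_rev]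
      exact inv_eq_of_mul_eq_one_right hQ.c_sq_sq
    refine hS.false_of_similitude_of_projection hQ h2 hrad hcx hE hCE (k := i * (c * c))
      (R.mul_mem hQ.mem_i (R.mul_mem hQ.mem_c hQ.mem_c)) ?_ ?_ ?_ ?_ ?_ ?_ hgω hl hsq ?_ hgj hgc hgx
      hix
    · rw [mul_assoc, ← mul_assoc (c * c), ← hcc, mul_assoc i (c * c), hQ.c_sq_sq, mul_one]
    · rw [mul_assoc, mul_assoc, hQ.c_j, ← mul_assoc c, hQ.c_j, ← mul_assoc, ← mul_assoc, hQ.i_j]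
      simp only [mul_assoc]
    · rw [← mul_assoc, hQ.c_i]
      simp only [mul_assoc]
    · rw [mul_assoc, mul_assoc, hcx, ← mul_assoc c, hcx, ← mul_assoc, ← mul_assoc, hix]
      simp only [mul_assoc]
    · intro h h1 h3
      have h4 : h * (c * c) = c * c * h := by
        rw [← mul_assoc, h3, mul_assoc, h3, ← mul_assoc, hinv]
      have h5 : i = i * (c * c) * (c * c) := by rw [mul_assoc, hQ.c_sq_sq, mul_one]
      rw [h5, ← mul_assoc, h1, mul_assoc _ h, h4, mul_assoc]
      simp only [mul_assoc]
    · rw [map_mul, map_mul, ← mul_assoc, hk, neg_mul]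
      have : E * (ρ c * ρ c) = ρ c * ρ c * E := by
        rw [← mul_assoc, hEC, mul_assoc, hEC, mul_assoc]
      rw [this, hCE, neg_neg]
    · have h1 : g * (ρ c * ρ c) = ρ c * ρ c * g := by
        rw [← mul_assoc, hgc, mul_assoc, hgc, ← mul_assoc, ← map_mul, hinv, map_mul]
      rw [map_mul, map_mul, ← mul_assoc, hgi, mul_assoc, h1]
      simp only [mul_assoc]

end IsIsometryRep

/-! ### Squares in `F`, the natural representation, and the Witt vectors. -/

section

variable {F : Type*} [Field F]

theorem isSquare_mul_of_not_isSquare [Finite F] {a b : F} (ha : ¬ IsSquare a) (hb : ¬ IsSquare b) :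
    IsSquare (a * b) := by
  classical
  have := Fintype.ofFinite F
  have h0 : a * b ≠ 0 :=
    mul_ne_zero (fun h => ha (h ▸ IsSquare.zero)) (fun h => hb (h ▸ IsSquare.zero))
  rw [← quadraticChar_one_iff_isSquare h0, map_mul, quadraticChar_neg_one_iff_not_isSquare.2 ha,
    quadraticChar_neg_one_iff_not_isSquare.2 hb, neg_one_mul, neg_neg]

theorem not_isSquare_two_of_card [Finite F] (h4 : 4 ∣ Nat.card F - 1)
    (h8 : ¬ 8 ∣ Nat.card F - 1) : ¬ IsSquare (2 : F) := by
  have := Fintype.ofFinite F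
  rw [FiniteField.isSquare_two_iff]
  rw [Nat.card_eq_fintype_card] at h4 h8
  have : 1 < Fintype.card F := Fintype.one_lt_card
  omega

namespace BlockTheory

/-- The natural representation of the symplectic group. -/
def Sp.rep (r : ℕ) (F : Type*) [Field F] : Representation F (Sp r F) (Fin r ⊕ Fin r → F) :=
  (Matrix.toLinAlgEquiv' : _ ≃ₐ[F] _).toMonoidHom.comp (Submonoid.subtype _)

theorem Sp.isIsometryRep (r : ℕ) (F : Type*) [Field F] :
    IsIsometryRep (Sp.rep r F) (Matrix.toLinearMap₂' F (Matrix.J (Fin r) F)) where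
  alt x := by
    rw [Matrix.toLinearMap₂'_apply', Matrix.J, Matrix.fromBlocks_mulVec]
    simp [dotProduct, Fintype.sum_sum_type, Matrix.neg_mulVec, mul_comm]
  nondeg x hx := by
    have h1 : Matrix.vecMul x (Matrix.J (Fin r) F) = 0 := by
      refine dotProduct_eq_zero _ fun y => ?_
      rw [← Matrix.dotProduct_mulVec, ← Matrix.toLinearMap₂'_apply']
      exact hx y
    have h2 := congrArg (fun v => Matrix.vecMul v (Matrix.J (Fin r) F)) h1
    simpa [Matrix.vecMul_vecMul, Matrix.J_squared, Matrix.vecMul_neg] using h2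
  injective _ _ h := Subtype.ext (Matrix.toLin'.injective h)
  isometry A x y := by
    have h := Matrix.toLinearMap₂'_comp (Matrix.J (Fin r) F) A.1 A.1
    rw [SymplecticGroup.mem_iff'.1 A.2] at h
    exact LinearMap.congr_fun₂ h x y
  full f hf := by
    refine ⟨⟨LinearMap.toMatrix' f, SymplecticGroup.mem_iff'.2 ?_⟩, Matrix.toLin'_toMatrix' f⟩
    have h := LinearMap.toMatrix₂'_compl₁₂ (Matrix.toLinearMap₂' F (Matrix.J (Fin r) F)) f f
    have h1 : (Matrix.toLinearMap₂' F (Matrix.J (Fin r) F)).compl₁₂ f f =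
      Matrix.toLinearMap₂' F (Matrix.J (Fin r) F) := LinearMap.ext₂ hf
    rw [h1, LinearMap.toMatrix'_toLinearMap₂'] at h
    exact h.symm

instance : CharZero O := by
  obtain ⟨c, hc⟩ := CharP.exists O
  rcases CharP.char_is_prime_or_zero O c with h | rfl
  · have h1 : ((c : ℕ) : AlgebraicClosure (ZMod 2)) = 0 := by
      rw [← map_natCast (WittVector.constantCoeff : O →+* _), CharP.cast_eq_zero, map_zero]
    rw [CharP.cast_eq_zero_iff _ 2, Nat.prime_dvd_prime_iff_eq Nat.prime_two h] at h1
    subst h1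
    exact absurd (CharP.cast_eq_zero O 2) (WittVector.p_nonzero 2 _)
  · exact CharP.charP_to_charZero O

instance : IsAdicComplete (Ideal.span {(2 : O)}) O := by
  have : IsAdicComplete (Ideal.span {((2 : ℕ) : O)}) O := inferInstance
  exact_mod_cast this

instance : IsArtinianRing (O ⧸ Ideal.span {(2 : O)}) := by
  have : IsArtinianRing (O ⧸ Ideal.span {((2 : ℕ) : O)}) :=
    (WittVector.quotientPEquiv (p := 2) (k := AlgebraicClosure (ZMod 2))).symm.isArtinianRing
  exact_mod_cast this

end BlockTheory

end

/-! ### The intersection of `D` with `H`, and the end of the proof. -/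

section

open BlockTheory

/-- If `R` is a `2`-subgroup of maximal order in the centralizer of `x`, then its normalizer there
has no elements of even order modulo `R`. -/
theorem IsPGroup.exists_odd_pow_mem {H : Type*} [Group H] [Finite H] {R : Subgroup H} {x y : H}
    (hR : IsPGroup 2 R) (hRx : ∀ r ∈ R, r * x = x * r)
    (hmax : ∀ S : Subgroup H, IsPGroup 2 S → (∀ s ∈ S, s * x = x * s) → Nat.card S ≤ Nat.card R)
    (hy : ∀ r ∈ R, y * r * y⁻¹ ∈ R) (hyx : y * x = x * y) : ∃ m, Odd m ∧ y ^ m ∈ R := by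
  obtain ⟨k, m, hm, hkm⟩ := Nat.exists_eq_two_pow_mul_odd (orderOf_pos y).ne'
  refine ⟨m, hm, ?_⟩
  have h1 : (y ^ m) ^ 2 ^ k = 1 := by rw [← pow_mul, mul_comm, ← hkm, pow_orderOf_eq_one]
  obtain ⟨n, -, hn⟩ := (Nat.dvd_prime_pow Nat.prime_two).1 (orderOf_dvd_of_pow_eq_one h1)
  have h2 : IsPGroup 2 (Subgroup.zpowers (y ^ m)) :=
    IsPGroup.of_card (n := n) (by rw [Nat.card_zpowers, hn])
  have h3 : Subgroup.zpowers (y ^ m) ≤ Subgroup.normalizer (R : Set H) := by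
    rw [Subgroup.zpowers_le]
    exact pow_mem (Subgroup.mem_normalizer_fintype hy) m
  have h4 : Subgroup.zpowers (y ^ m) ⊔ R ≤ Subgroup.centralizer {x} := by
    refine sup_le ?_ fun r hr => Subgroup.mem_centralizer_singleton_iff.2 (hRx r hr)
    rw [Subgroup.zpowers_le]
    exact pow_mem (Subgroup.mem_centralizer_singleton_iff.2 hyx) m
  have h5 := Subgroup.eq_of_le_of_card_ge (le_sup_right : R ≤ Subgroup.zpowers (y ^ m) ⊔ R)
    (hmax _ (IsPGroup.to_sup_of_normal_right' h2 hR h3) fun s hs =>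
      Subgroup.mem_centralizer_singleton_iff.1 (h4 hs))
  rw [h5]
  exact Subgroup.mem_sup_left (Subgroup.mem_zpowers _)

theorem Subgroup.index_le_two_of_mul_mem {E : Type*} [Group E] {R : Subgroup E}
    (hR : ∀ a b, a ∉ R → b ∉ R → a * b ∈ R) : R.index ≤ 2 := by
  by_cases h : R = ⊤
  · rw [h, Subgroup.index_top]
    exact one_le_two
  · obtain ⟨a, ha⟩ := SetLike.exists_not_mem_of_ne_top R h
    refine (Subgroup.index_eq_two_iff.2 ⟨a, fun b => ?_⟩).le
    by_cases hb : b ∈ R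
    · exact .inr ⟨hb, fun h => ha ((R.mul_mem_cancel_left hb).1 h)⟩
    · exact .inl ⟨hR b a hb ha, hb⟩

namespace IsIsometryRep

variable {F V H G : Type*} [Field F] [AddCommGroup V] [Module F V] [Group H] [Group G]
  {ρ : Representation F H V} {ω : V →ₗ[F] V →ₗ[F] F} {ι : H →* G} {κ : G → MulAut H}

/-- The automorphism is conjugation by some `k` in `H`, so `d` differs from `ι k` by an element of
`C_G(H) ≤ H`. -/
theorem mem_range_of_isSquare (hS : IsIsometryRep ρ ω) [Finite V]
    (hcent : Subgroup.centralizer (ι.range : Set G) ≤ ι.range)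
    (hκ : ∀ g h, ι (κ g h) = g * ι h * g⁻¹) {d : G} {g : V →ₗ[F] V} {l : F}
    (hinj : Function.Injective g) (hl : l ≠ 0) (hg : ∀ h v, g (ρ h v) = ρ (κ d h) (g v))
    (hgω : ∀ x y, ω (g x) (g y) = l * ω x y) (hsq : IsSquare l) : d ∈ ι.range := by
  obtain ⟨k, hk⟩ := hS.exists_eq_conj_of_isSquare hinj hl hg hgω hsq
  have h1 : (ι k)⁻¹ * d ∈ ι.range := by
    refine hcent (Subgroup.mem_centralizer_iff.2 ?_)
    rintro _ ⟨h, rfl⟩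
    have h2 := hκ d h
    rw [hk, map_mul, map_mul, map_inv] at h2
    rw [mul_assoc (ι k)⁻¹, ← eq_mul_inv_iff_mul_eq.1 h2]
    group
  simpa using mul_mem (⟨k, rfl⟩ : ι k ∈ ι.range) h1

/-- What remains once block theory has produced `x₀`: `hP` bounds the `2`-subgroups of its
centralizer, while `D` centralizes it. -/
theorem false_of_isDefectGroup (hS : IsIsometryRep ρ ω) [Finite F] [Finite V]
    [FiniteDimensional F V] [Nontrivial V] [Finite G] (h4 : 4 ∣ Nat.card F - 1)
    (h8 : ¬ 8 ∣ Nat.card F - 1) (hι : Function.Injective ι)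
    (hcent : Subgroup.centralizer (ι.range : Set G) ≤ ι.range)
    (hκ : ∀ g h, ι (κ g h) = g * ι h * g⁻¹) {P : Subgroup H} (eP : P ≃* Q8 × C4) {x₀ : H}
    (hP : ∀ S : Subgroup H, IsPGroup 2 S → (∀ s ∈ S, s * x₀ = x₀ * s) →
      ∃ y, ∀ s ∈ S, y⁻¹ * s * y ∈ P)
    {D : Subgroup G} (e : D ≃* Q8 × Q8) (hDx : ∀ d ∈ D, d * ι x₀ = ι x₀ * d) : False := by
  have : Finite H := Finite.of_injective ι hι
  have h2 : ¬ IsSquare (2 : F) := not_isSquare_two_of_card h4 h8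
  have h20 : (2 : F) ≠ 0 := fun h => h2 (h ▸ IsSquare.zero)
  have hcardD : Nat.card D = 2 ^ 6 := by
    rw [Nat.card_congr e.toEquiv, Nat.card_prod, Nat.card_eq_fintype_card, QuaternionGroup.card]
    norm_num
  have hcardP : Nat.card P = 2 ^ 5 := by
    rw [Nat.card_congr eP.toEquiv, Nat.card_prod, Nat.card_eq_fintype_card, QuaternionGroup.card,
      Nat.card_eq_fintype_card, Fintype.card_multiplicative, ZMod.card]
    norm_num
  have hsim : ∀ d ∈ D, ∃ (g : V →ₗ[F] V) (l : F), Function.Injective g ∧ l ≠ 0 ∧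
      (∀ h v, g (ρ h v) = ρ (κ d h) (g v)) ∧ ∀ x y, ω (g x) (g y) = l * ω x y := by
    intro d hd
    refine hS.exists_similitude h4 h8 h20 (κ d) fun h => hι ?_
    have h1 : d * d * (d * d) = 1 := by
      have h2 : (⟨d, hd⟩ : D) * ⟨d, hd⟩ * (⟨d, hd⟩ * ⟨d, hd⟩) = 1 := by
        refine e.injective ?_
        simp only [map_mul, map_one]
        exact Prod.ext (Q8.pow_four _) (Q8.pow_four _)
      exact congrArg Subtype.val h2
    simp only [hκ]
    calc d * (d * (d * (d * ι h * d⁻¹) * d⁻¹) * d⁻¹) * d⁻¹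
        = (d * d * (d * d)) * ι h * (d * d * (d * d))⁻¹ := by group
      _ = ι h := by rw [h1]; group
  have hmul : ∀ a ∈ D, ∀ b ∈ D, a ∉ ι.range → b ∉ ι.range → a * b ∈ ι.range := by
    intro a ha b hb har hbr
    obtain ⟨g, l, hinj, hl, hg, hgω⟩ := hsim a ha
    obtain ⟨g', l', hinj', hl', hg', hgω'⟩ := hsim b hb
    refine hS.mem_range_of_isSquare (g := g ∘ₗ g') (l := l * l') hcent hκ (hinj.comp hinj')
      (mul_ne_zero hl hl') (fun h v => ?_) (fun x y => ?_) (isSquare_mul_of_not_isSquare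
        (fun h => har (hS.mem_range_of_isSquare hcent hκ hinj hl hg hgω h))
        (fun h => hbr (hS.mem_range_of_isSquare hcent hκ hinj' hl' hg' hgω' h)))
    · have h1 : κ (a * b) h = κ a (κ b h) := hι (by simp only [hκ]; group)
      rw [LinearMap.comp_apply, hg', hg, h1, LinearMap.comp_apply]
    · rw [LinearMap.comp_apply, LinearMap.comp_apply, hgω, hgω', mul_assoc]
  set RD : Subgroup D := ι.range.subgroupOf D with hRD
  set R : Subgroup H := D.comap ι with hR
  have hidx : ∀ a b, a ∉ RD → b ∉ RD → a * b ∈ RD := fun a b ha hb =>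
    hmul a a.2 b b.2 ha hb
  have hmap : RD.map D.subtype = R.map ι := by
    rw [Subgroup.subgroupOf_map_subtype, Subgroup.map_comap_eq]
  have hcardR : 2 ^ 5 ≤ Nat.card R := by
    have h1 := RD.card_mul_index
    rw [hcardD, ← Subgroup.card_map_of_injective D.subtype_injective, hmap,
      Subgroup.card_map_of_injective hι] at h1
    have h3 := Nat.mul_le_mul_left (Nat.card R) (Subgroup.index_le_two_of_mul_mem hidx)
    omega
  have hR2 : IsPGroup 2 R := (IsPGroup.of_card hcardD).comap_of_injective ι hι
  have hRx : ∀ r ∈ R, r * x₀ = x₀ * r := fun r hr => hι (by rw [map_mul, map_mul, hDx _ hr])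
  have hconj : ∀ {S : Subgroup H} {y : H}, (∀ s ∈ S, y⁻¹ * s * y ∈ P) →
      S.map (MulAut.conj y⁻¹).toMonoidHom ≤ P := by
    rintro S y hy _ ⟨s, hs, rfl⟩
    simpa using hy s hs
  have hle : ∀ S : Subgroup H, IsPGroup 2 S → (∀ s ∈ S, s * x₀ = x₀ * s) → Nat.card S ≤ 2 ^ 5 := by
    intro S hS2 hSx
    obtain ⟨y, hy⟩ := hP S hS2 hSx
    rw [← hcardP, ← Subgroup.card_map_of_injective (f := (MulAut.conj y⁻¹).toMonoidHom)
        (MulAut.conj y⁻¹).injective]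
    exact Subgroup.card_le_of_le (hconj hy)
  obtain ⟨y, hy⟩ := hP R hR2 hRx
  have hPR : R.map (MulAut.conj y⁻¹).toMonoidHom = P :=
    Subgroup.eq_of_le_of_card_ge (hconj hy) (by
      rw [Subgroup.card_map_of_injective (f := (MulAut.conj y⁻¹).toMonoidHom)
        (MulAut.conj y⁻¹).injective, hcardP]
      exact hcardR)
  -- A generator of the cyclic factor, central of order `4` in `P`. Conjugated back to `R`, it rules
  -- out the subgroups of index at most `2` in `Q₈ × Q₈` other than `⟨x⟩ × Q₈` and its mirror image.
  set p₀ : P := eP.symm (1, Multiplicative.ofAdd 1) with hp₀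
  obtain ⟨p, hpR, hp⟩ : (p₀ : H) ∈ R.map (MulAut.conj y⁻¹).toMonoidHom := hPR ▸ p₀.2
  have hp₀c : ∀ s : P, s * p₀ = p₀ * s := by
    intro s
    refine eP.injective ?_
    rw [map_mul, map_mul, hp₀, MulEquiv.apply_symm_apply]
    exact Prod.ext (by simp) (mul_comm _ _)
  have hpp : p * p ≠ 1 := by
    intro h
    have h1 : p₀ * p₀ = 1 := Subtype.ext (by
      rw [Subgroup.coe_mul, ← hp, ← map_mul, h, map_one, Subgroup.coe_one])
    rw [hp₀, ← map_mul, map_eq_one_iff _ eP.symm.injective] at h1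
    exact absurd (congrArg Prod.snd h1) (by decide)
  have hpc : ∀ r ∈ R, r * p = p * r := by
    intro r hr
    refine (MulAut.conj y⁻¹).injective ?_
    have h1 : MulAut.conj y⁻¹ r ∈ P := hPR ▸ ⟨r, hr, rfl⟩
    rw [map_mul, map_mul]
    have h3 := congrArg Subtype.val (hp₀c ⟨_, h1⟩)
    simp only [Subgroup.coe_mul, ← hp] at h3
    exact h3
  have hRDmem : ∀ a ∈ RD, ∃ h ∈ R, ι h = a := by
    intro a ha
    obtain ⟨h, hh⟩ := ha
    exact ⟨h, (by rw [hR, Subgroup.mem_comap, hh]; exact a.2), hh⟩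
  obtain ⟨i, j, c, d, hQ, hd, hdi, hdj, hdc⟩ := Q8.exists_generators e hidx
    (p := ⟨ι p, hpR⟩) (fun a ha => by
      obtain ⟨h, hh, ha'⟩ := hRDmem a ha
      refine Subtype.ext ?_
      rw [Subgroup.coe_mul, Subgroup.coe_mul, ← ha', ← map_mul, ← map_mul, hpc h hh])
    (fun h => hpp (hι (by
      rw [map_mul, map_one]
      exact congrArg Subtype.val h)))
  obtain ⟨i', hi'R, hi'⟩ := hRDmem i hQ.mem_i
  obtain ⟨j', hj'R, hj'⟩ := hRDmem j hQ.mem_j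
  obtain ⟨c', hc'R, hc'⟩ := hRDmem c hQ.mem_c
  have hQ' : IsQuaternionCyclic R i' j' c' := by
    rw [← isQuaternionCyclic_map_iff hι, ← hmap, hi', hj', hc']
    exact (isQuaternionCyclic_map_iff D.subtype_injective).2 hQ
  obtain ⟨g, l, hinj, hl, hg, hgω⟩ := hsim d d.2
  have hlsq : ¬ IsSquare l := fun h => hd (hS.mem_range_of_isSquare hcent hκ hinj hl hg hgω h)
  have hκi : ∀ {a b : H}, (d : G) * ι a = ι b * d → g * ρ a = ρ b * g := by
    intro a b hab
    have h1 : κ d a = b := hι (by rw [hκ, hab, mul_inv_cancel_right])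
    exact LinearMap.ext fun v => by rw [Module.End.mul_apply, hg, h1, Module.End.mul_apply]
  refine hS.false_of_similitude hQ' h20
    (fun y h1 h3 => hR2.exists_odd_pow_mem hRx (fun S h5 h6 => (hle S h5 h6).trans hcardR) h1 h3)
    (hRx _ hi'R) (hRx _ hc'R) hgω hl (isSquare_mul_of_not_isSquare h2 hlsq)
    (hκi ?_) (hκi ?_) (hκi ?_) (hκi (hDx _ d.2))
  · rw [hi']
    exact congrArg Subtype.val hdi
  · rw [hj']
    exact congrArg Subtype.val hdj
  · rw [map_inv, hc']
    exact congrArg Subtype.val hdc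

end IsIsometryRep

end

theorem mainTheorem9 {F : Type*} [Field F] [Finite F] (q : ℕ) (hq : Nat.card F = q)
    (h4 : 4 ∣ q - 1) (h8 : ¬ 8 ∣ q - 1) (r : ℕ)
    (b : MonoidAlgebra BlockTheory.O (BlockTheory.Sp r F)) (hb : BlockTheory.IsBlock b)
    (P : Subgroup (BlockTheory.Sp r F)) (hP : BlockTheory.IsDefectGroup b P)
    (hPiso : Nonempty (P ≃* BlockTheory.Q8 × BlockTheory.C4))
    {G : Type*} [Group G] [Finite G] (ι : BlockTheory.Sp r F →* G)
    (hι : Function.Injective ι) (hnormal : ι.range.Normal)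
    (hcent : Subgroup.centralizer (ι.range : Set G) ≤ ι.range)
    (B : MonoidAlgebra BlockTheory.O G) (hB : BlockTheory.IsBlock B)
    (hcov : BlockTheory.Covers ι B b)
    (D : Subgroup G) (hD : BlockTheory.IsDefectGroup B D) :
    ¬ Nonempty (D ≃* BlockTheory.Q8 × BlockTheory.Q8) := by
  rintro ⟨e⟩
  obtain ⟨eP⟩ := hPiso
  subst hq
  have hS := BlockTheory.Sp.isIsometryRep r F
  -- For `r = 0` the group is trivial and has no subgroup `Q₈ × C₄`; later arguments need a nonzero
  -- vector.
  have hr : Nonempty (Fin r) := by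
    rw [← Fin.pos_iff_nonempty, Nat.pos_iff_ne_zero]
    rintro rfl
    have h1 : Subsingleton (BlockTheory.Sp 0 F) := ⟨fun A B => Subtype.ext (Subsingleton.elim _ _)⟩
    have h3 : (eP.symm (1, Multiplicative.ofAdd 1)) = 1 := Subtype.ext (Subsingleton.elim _ _)
    rw [map_eq_one_iff _ eP.symm.injective] at h3
    exact absurd (congrArg Prod.snd h3) (by decide)
  have : Finite (BlockTheory.Sp r F) := Finite.of_injective ι hι
  let κ : G → MulAut (BlockTheory.Sp r F) := fun g => ((MonoidHom.ofInjective hι).trans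
    (MulAut.conjNormal g : MulAut ι.range)).trans (MonoidHom.ofInjective hι).symm
  have hκ : ∀ g h, ι (κ g h) = g * ι h * g⁻¹ := by
    intro g h
    have h1 := (MonoidHom.ofInjective hι).apply_symm_apply
      ((MulAut.conjNormal g : MulAut ι.range) (MonoidHom.ofInjective hι h))
    exact congrArg Subtype.val h1
  have hD2 : IsPGroup 2 D := by
    refine IsPGroup.of_card (n := 6) ?_
    rw [Nat.card_congr e.toEquiv, Nat.card_prod, Nat.card_eq_fintype_card, QuaternionGroup.card]
    norm_num
  obtain ⟨g, x₀, hg, hx₀⟩ := BlockTheory.exists_centralized_not_two_dvd_coeff ι hι κ hκ hb hB hcov hD hD2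
  obtain ⟨a, ha, rfl⟩ := hP.prop
  refine hS.false_of_isDefectGroup h4 h8 hι hcent hκ eP (x₀ := x₀)
    (fun S hS hSx => BlockTheory.exists_conj_mem_of_not_two_dvd_coeff ha hx₀ hS hSx)
    -- Only a conjugate of `D` centralizes `x₀`, and it serves equally well.
    (D := D.map (MulAut.conj g).toMonoidHom)
    ((D.equivMapOfInjective _ (MulAut.conj g).injective).symm.trans e) ?_
  rintro _ ⟨d, hd, rfl⟩
  exact hg d hd
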